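/- Let $c>0$ and $d$ be real constants. For a polynomial $p(x)=\sum_{i=0}^n p_i x^i=p_n\prod_{j=1}^n(x-x_j)$ of degree $n\ge 1$ with real coefficients and complex roots $x_1,\dots,x_n$ (listed with multiplicity), let $r_1\ge r_2\ge\cdots\ge r_n$ denote its root radii, that is, the numbers $|x_1|,\dots,|x_n|$ arranged in nonincreasing order. Then there is an algorithm (a single one for all $n$ and all $p$, depending only on $c$ and $d$) that, given $n$ and the coefficients $p_0,\dots,p_n$ of such a polynomial, computes $n$ real numbers $\tilde r_1,\dots,\tilde r_n$ such that $$\tilde r_j\le r_j\le \Bigl(1+\frac{c}{n^d}\Bigr)\tilde r_j,\qquad j=1,\dots,n,$$ and uses $O(n\log^2 n)$ arithmetic operations as $n\to\infty$, with a constant that depends only on $c$ and $d$. Here the computation is exact, on a real random access machine; the operations are $+,-,\times,\div$ and comparisons of real numbers and the extraction of the nonnegative $m$-th root of a nonnegative real number for an integer $m\ge 1$, each counted as one operation. (The bound even covers all executed instructions, including the handling of integer indices and of loops.) -/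

import Mathlib

/-!
A real random access machine.  A state has two memories, one of exact real numbers and one of
natural numbers; the latter is used for addresses, counters and root indices only.  Programs are
finite, contain no real constants, and information passes from the reals to the naturals only
through comparisons.  All loops are bounded, so that every program halts on every input.
-/

namespace RealRAM

/-- The memory of the machine: cells for natural numbers and cells for real numbers. -/
@[ext]
structure State where
  nats : ℕ → ℕ
  reals : ℕ → ℝ

/-- Address (index) expressions; `sub` is truncated, `div` and `mod` are those of `ℕ`. -/
inductive NatExpr where
  | lit (k : ℕ)
  | load (a : NatExpr)
  | add (a b : NatExpr)
  | sub (a b : NatExpr)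
  | mul (a b : NatExpr)
  | div (a b : NatExpr)
  | mod (a b : NatExpr)

/-- The value of an address expression; `load a` is the content of the natural number cell `a`. -/
def NatExpr.eval (s : State) : NatExpr → ℕ
  | lit k => k
  | load a => s.nats (a.eval s)
  | add a b => a.eval s + b.eval s
  | sub a b => a.eval s - b.eval s
  | mul a b => a.eval s * b.eval s
  | div a b => a.eval s / b.eval s
  | mod a b => a.eval s % b.eval s

/-- The four arithmetic operations. -/
inductive ArithOp where
  | add
  | sub
  | mul
  | div

/-- The exact result of an arithmetic operation; division by zero returns zero. -/
noncomputable def ArithOp.eval : ArithOp → ℝ → ℝ → ℝ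
  | add, x, y => x + y
  | sub, x, y => x - y
  | mul, x, y => x * y
  | div, x, y => x / y

/-- The nonnegative `m`-th root of a nonnegative real number, for `m ≥ 1`; zero otherwise. -/
noncomputable def rootOp (m : ℕ) (x : ℝ) : ℝ :=
  if 1 ≤ m ∧ 0 ≤ x then x ^ ((m : ℝ)⁻¹) else 0

/-- Programs. -/
inductive Prog where
  /-- do nothing -/
  | skip
  /-- `N[dst] := e` -/
  | setNat (dst e : NatExpr)
  /-- `R[dst] := e`, the natural number `e` being regarded as a real number -/
  | setReal (dst e : NatExpr)
  /-- `R[dst] := R[a]` -/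
  | copy (dst a : NatExpr)
  /-- `R[dst] := R[a] op R[b]` -/
  | arith (op : ArithOp) (dst a b : NatExpr)
  /-- `R[dst] :=` the `m`-th root of `R[a]` -/
  | root (dst m a : NatExpr)
  /-- `P; Q` -/
  | seq (P Q : Prog)
  /-- if `a ≤ b` then `P` else `Q` -/
  | ifNat (a b : NatExpr) (P Q : Prog)
  /-- if `R[a] ≤ R[b]` then `P` else `Q` -/
  | ifReal (a b : NatExpr) (P Q : Prog)
  /-- evaluate `e` once, then execute `P` that many times -/
  | loop (e : NatExpr) (P : Prog)

/-- Store a natural number. -/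
def State.storeNat (s : State) (i v : ℕ) : State :=
  { s with nats := Function.update s.nats i v }

/-- Store a real number. -/
noncomputable def State.storeReal (s : State) (i : ℕ) (v : ℝ) : State :=
  { s with reals := Function.update s.reals i v }

/-- The state after the execution of a program. -/
noncomputable def Prog.run : Prog → State → State
  | skip, s => s
  | setNat dst e, s => s.storeNat (dst.eval s) (e.eval s)
  | setReal dst e, s => s.storeReal (dst.eval s) (e.eval s : ℝ)
  | copy dst a, s => s.storeReal (dst.eval s) (s.reals (a.eval s))
  | arith op dst a b, s =>
      s.storeReal (dst.eval s) (op.eval (s.reals (a.eval s)) (s.reals (b.eval s)))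
  | root dst m a, s => s.storeReal (dst.eval s) (rootOp (m.eval s) (s.reals (a.eval s)))
  | seq P Q, s => Q.run (P.run s)
  | ifNat a b P Q, s => if a.eval s ≤ b.eval s then P.run s else Q.run s
  | ifReal a b P Q, s =>
      if s.reals (a.eval s) ≤ s.reals (b.eval s) then P.run s else Q.run s
  | loop e P, s => P.run^[e.eval s] s

/-- The number of instructions executed by a program.  Every assignment (also of natural
numbers), arithmetic operation, root extraction and comparison, every start of a loop and every
pass through a loop counts one, so that in particular the number of operations on real numbers
is at most this number. -/
noncomputable def Prog.cost : Prog → State → ℕ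
  | skip, _ => 0
  | setNat _ _, _ => 1
  | setReal _ _, _ => 1
  | copy _ _, _ => 1
  | arith _ _ _ _, _ => 1
  | root _ _ _, _ => 1
  | seq P Q, s => P.cost s + Q.cost (P.run s)
  | ifNat a b P Q, s => 1 + if a.eval s ≤ b.eval s then P.cost s else Q.cost s
  | ifReal a b P Q, s =>
      1 + if s.reals (a.eval s) ≤ s.reals (b.eval s) then P.cost s else Q.cost s
  | loop e P, s => 1 + ∑ i ∈ Finset.range (e.eval s), (1 + P.cost (P.run^[i] s))

/-- The initial state for a real polynomial `p`: its degree is in the natural number cell `0`,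
its coefficients `p_0, p_1, …, p_n` are in the real cells `0, 1, …, n`; all other cells hold `0`. -/
noncomputable def inputState (p : Polynomial ℝ) : State where
  nats := fun i => if i = 0 then p.natDegree else 0
  reals := fun i => p.coeff i

end RealRAM

/-- The absolute values of the complex roots of `p`, repeated according to multiplicity, in
nonincreasing order. -/
noncomputable def rootRadii (p : Polynomial ℝ) : List ℝ :=
  ((p.map (algebraMap ℝ ℂ)).roots.map fun x => ‖x‖).sort (· ≥ ·)

/-- A polynomial of degree `n` has `n` root radii. -/
theorem length_rootRadii (p : Polynomial ℝ) : (rootRadii p).length = p.natDegree := by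
  simp only [rootRadii, Multiset.length_sort, Multiset.card_map]
  rw [IsAlgClosed.card_roots_eq_natDegree, Polynomial.natDegree_map]

/-- The root radius `r_{j+1}` of `p`, for `0 ≤ j < deg p`, so that `r_1 ≥ r_2 ≥ ⋯ ≥ r_n`. -/
noncomputable def rootRadius (p : Polynomial ℝ) (j : Fin p.natDegree) : ℝ :=
  (rootRadii p).get (j.cast (length_rootRadii p).symm)

/-! Write `M = E * N` with `N` a power of two, `2 * n < N ≤ 4 * n`. Repeated root squaring replaces
`p` by a polynomial `q` of the same degree whose roots are the `M`-th powers of those of `p`. Even a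
crude estimate of the root radii of `q`, off by a factor `4 ^ n`, then suffices: after an `M`-th
root the error factor is at most `1 + 1 / E`, since `(1 + 1 / E) ^ (E * N) ≥ 2 ^ N ≥ 4 ^ n`.

The crude estimate comes from the Newton polygon of the absolute values of the coefficients. The
Mahler measure of `q (t * X)` is `|lead q| * ∏ max t |x_j|`, and it agrees with the largest `|q_i| *
t ^ i` up to factors `2 ^ n` in both directions (`TropicallyClose`). As a function of `t` the
product has logarithmic slope equal to the number of roots inside the circle of radius `t`, while a
single monomial has slope `i`. If the monomial `i` is maximal at `t` and its slope is inconsistent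
with the location of a root radius, the two sides drift apart by at least one power of the ratio, so
this ratio is at most `4 ^ n` (`TropicallyClose.le_of_vertex`, `TropicallyClose.ge_of_vertex`). At a
break point of the polygon two monomials are maximal, which bounds the radius from both sides
(`TropicallyClose.isNewtonRadius`).

For the running time, one squaring evaluates `q(x) * q(-x)` at the `N`-th roots of unity, by a fast
Fourier transform, and a second forward transform recovers the coefficients up to order and the
factor `N`, which does not affect roots (`Prog.meets_squareRoots`). This costs `O(n log n)`. With `E
= 2 ^ (κ + D * L)` and `N = 2 ^ L` there are `κ + (D + 1) * L = O(log n)` squarings, and `E ≥ 2 ^ κ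
* n ^ D` gives the required precision. The root of unity is obtained from `-1` by successive square
roots. The polygon is a convex hull of points sorted by index, found in linear time with a stack
(`Prog.run_newtonStep`), and the radii are read off in linear time as well. -/

/-! ### Root squaring -/

open Polynomial in
/-- A constant multiple of the polynomial whose roots are the squares of the roots of `q`. -/
noncomputable def graeffe (K : ℝ) (q : Polynomial ℝ) : Polynomial ℝ :=
  C K * contract 2 (q * q.comp (-X))

-- Pairing the factors of `f(X)` and `f(-X)` gives `(X - x) * (-X - x) = -(X ^ 2 - x ^ 2)` for each
-- root, so the product is a polynomial in `X ^ 2`, and `contract` undoes the substitution.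
open Polynomial in
theorem contract_two_mul_comp_neg (f : Polynomial ℂ) :
    contract 2 (f * f.comp (-X)) =
      C ((-1) ^ f.roots.card * f.leadingCoeff ^ 2) *
        ((f.roots.map (· ^ 2)).map fun x => X - C x).prod := by
  have hs := (IsAlgClosed.splits f).eq_prod_roots
  have key : f * f.comp (-X) = expand ℂ 2 (C ((-1) ^ f.roots.card * f.leadingCoeff ^ 2) *
        ((f.roots.map (· ^ 2)).map fun x => X - C x).prod) := by
    conv_lhs => rw [hs]
    rw [map_mul, map_multiset_prod, mul_comp, multiset_prod_comp, C_comp, expand_C,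
      Multiset.map_map, Multiset.map_map, Multiset.map_map]
    have h1 : (f.roots.map (fun x => (X - C x : ℂ[X]))).prod *
        (f.roots.map ((fun p => p.comp (-X)) ∘ fun x => (X - C x : ℂ[X]))).prod =
        C ((-1) ^ f.roots.card) * (f.roots.map
          ((⇑(expand ℂ 2) ∘ fun x => (X - C x : ℂ[X])) ∘ fun x => x ^ 2)).prod := by
      rw [← Multiset.prod_map_mul]
      have : C ((-1 : ℂ) ^ f.roots.card) = (f.roots.map fun _ => (-1 : ℂ[X])).prod := by
        rw [Multiset.map_const', Multiset.prod_replicate]; simp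
      rw [this, ← Multiset.prod_map_mul]
      congr 1
      apply Multiset.map_congr rfl
      intro x _
      simp only [Function.comp, sub_comp, X_comp, C_comp, map_sub, expand_X, expand_C]
      rw [C_pow]
      ring
    rw [mul_mul_mul_comm, h1]
    simp only [C_mul, C_pow]
    ring
  rw [key, contract_expand _ (by norm_num)]

open Polynomial in
theorem map_graeffe (K : ℝ) (q : Polynomial ℝ) :
    (graeffe K q).map (algebraMap ℝ ℂ) =
      C (K : ℂ) * contract 2 (q.map (algebraMap ℝ ℂ) * (q.map (algebraMap ℝ ℂ)).comp (-X)) := by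
  rw [graeffe, Polynomial.map_mul, map_C, map_contract (by norm_num), Polynomial.map_mul,
    map_comp]
  simp

-- The free nonzero constant `K` allows the squaring program to skip the normalisation of the
-- Fourier transform.
open Polynomial in
theorem roots_graeffe {K : ℝ} (hK : K ≠ 0) {q : Polynomial ℝ} (hq : q ≠ 0) :
    ((graeffe K q).map (algebraMap ℝ ℂ)).roots =
      (q.map (algebraMap ℝ ℂ)).roots.map (· ^ 2) := by
  have h0 : q.map (algebraMap ℝ ℂ) ≠ 0 :=
    (Polynomial.map_ne_zero_iff (algebraMap ℝ ℂ).injective).2 hq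
  rw [map_graeffe, contract_two_mul_comp_neg, roots_C_mul _ (by exact_mod_cast hK), roots_C_mul,
    roots_multiset_prod_X_sub_C]
  simp [hq]

theorem natDegree_graeffe {K : ℝ} (hK : K ≠ 0) {q : Polynomial ℝ} (hq : q ≠ 0) :
    (graeffe K q).natDegree = q.natDegree := by
  rw [← Polynomial.natDegree_map (algebraMap ℝ ℂ), ← IsAlgClosed.card_roots_eq_natDegree,
    roots_graeffe hK hq, Multiset.card_map, IsAlgClosed.card_roots_eq_natDegree,
    Polynomial.natDegree_map]

theorem coeff_graeffe (K : ℝ) (q : Polynomial ℝ) (i : ℕ) :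
    (graeffe K q).coeff i = K * (q * q.comp (-Polynomial.X)).coeff (2 * i) := by
  rw [graeffe, Polynomial.coeff_C_mul, Polynomial.coeff_contract (by norm_num), mul_comm i]

/-! ### Coefficients against root radii, via the Mahler measure -/

-- The Mahler measure is multiplicative, and the linear factor `t * X - x` has measure `max t ‖x‖`.
open Polynomial in
theorem mahlerMeasure_comp_C_mul_X (q : Polynomial ℂ) {t : ℝ} (ht : 0 < t) :
    (q.comp (C (t : ℂ) * X)).mahlerMeasure =
      ‖q.leadingCoeff‖ * (q.roots.map fun x => max t ‖x‖).prod := by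
  have hs := (IsAlgClosed.splits q).eq_prod_roots
  conv_lhs => rw [hs]
  rw [mul_comp, multiset_prod_comp, C_comp, mahlerMeasure_mul, mahlerMeasure_const,
     prod_mahlerMeasure_eq_mahlerMeasure_prod, Multiset.map_map, Multiset.map_map]
  congr 2
  apply Multiset.map_congr rfl
  intro x _
  have ht' : (t : ℂ) ≠ 0 := by exact_mod_cast ht.ne'
  have h : (X - C x : ℂ[X]).comp (C (t : ℂ) * X) = C (t : ℂ) * X + C (-x) := by
    simp [sub_eq_add_neg]
  simp only [Function.comp, h]
  rw [mahlerMeasure_C_mul_X_add_C ht', norm_neg, Complex.norm_real, Real.norm_of_nonneg ht.le]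

theorem coeff_comp_C_mul_X {R : Type*} [CommSemiring R] (q : Polynomial R) (t : R) (i : ℕ) :
    (q.comp (Polynomial.C t * Polynomial.X)).coeff i = q.coeff i * t ^ i := by
  rw [Polynomial.comp_C_mul_X_coeff]

open Polynomial in
theorem abs_coeff_mul_pow_le (q : Polynomial ℝ) {t : ℝ} (ht : 0 < t) (i : ℕ) :
    |q.coeff i| * t ^ i ≤ 2 ^ q.natDegree *
      (|q.leadingCoeff| * ((q.map (algebraMap ℝ ℂ)).roots.map fun x => max t ‖x‖).prod) := by
  have h := norm_coeff_le_choose_mul_mahlerMeasure i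
    ((q.map (algebraMap ℝ ℂ)).comp (C (t : ℂ) * X))
  rw [mahlerMeasure_comp_C_mul_X _ ht, coeff_comp_C_mul_X, coeff_map, norm_mul, norm_pow,
    Complex.norm_real, Real.norm_of_nonneg ht.le, leadingCoeff_map, natDegree_comp] at h
  simp only [Complex.coe_algebraMap, Complex.norm_real, Real.norm_eq_abs, natDegree_map] at h
  refine h.trans (mul_le_mul_of_nonneg_right ?_ ?_)
  · have h1 : (C (t : ℂ) * X : ℂ[X]).natDegree = 1 :=
      natDegree_C_mul_X _ (by exact_mod_cast ht.ne')
    rw [h1, mul_one]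
    exact_mod_cast Nat.choose_le_two_pow _ _
  · refine mul_nonneg (abs_nonneg _) (Multiset.prod_nonneg ?_)
    intro a ha
    obtain ⟨x, _, rfl⟩ := Multiset.mem_map.1 ha
    exact ht.le.trans (le_max_left _ _)

open Polynomial in
theorem leadingCoeff_mul_prod_max_le (q : Polynomial ℝ) {t : ℝ} (ht : 0 < t) {B : ℝ}
    (hB : ∀ i, |q.coeff i| * t ^ i ≤ B) :
    |q.leadingCoeff| * ((q.map (algebraMap ℝ ℂ)).roots.map fun x => max t ‖x‖).prod ≤
      2 ^ q.natDegree * B := by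
  have h := mahlerMeasure_le_sum_norm_coeff ((q.map (algebraMap ℝ ℂ)).comp (C (t : ℂ) * X))
  rw [mahlerMeasure_comp_C_mul_X _ ht, leadingCoeff_map] at h
  simp only [Complex.coe_algebraMap, Complex.norm_real, Real.norm_eq_abs] at h
  refine h.trans ?_
  have hB0 : 0 ≤ B := (by positivity : 0 ≤ |q.coeff 0| * t ^ 0).trans (hB 0)
  have hd : ((q.map (algebraMap ℝ ℂ)).comp (C (t : ℂ) * X)).natDegree = q.natDegree := by
    rw [natDegree_comp, natDegree_C_mul_X _ (by exact_mod_cast ht.ne'), mul_one, natDegree_map]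
  rw [sum_over_range _ (by simp), hd]
  calc _ ≤ ∑ i ∈ Finset.range (q.natDegree + 1), B := by
        refine Finset.sum_le_sum fun i _ => ?_
        rw [coeff_comp_C_mul_X, coeff_map, norm_mul, norm_pow, Complex.norm_real,
          Real.norm_of_nonneg ht.le]
        simpa using hB i
    _ = ((q.natDegree + 1 : ℕ) : ℝ) * B := by simp
    _ ≤ _ := by
        -- The number of terms, `n + 1`, is at most `2 ^ n`; this makes both comparison factors
        -- equal.
        refine mul_le_mul_of_nonneg_right ?_ hB0
        exact_mod_cast Nat.lt_two_pow_self

/-! ### Growth of `∏ max t (f i)` against growth of monomials -/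

section Comparison

variable {n : ℕ} {f : Fin n → ℝ}

/-- Only the `n - 1 - j` factors with index beyond `j` can grow between `t` and `r`: the others are
at least `f j ≥ r` and do not feel the change. -/
theorem prod_max_le_pow_mul {r t : ℝ} (ht : 0 < t) (htr : t ≤ r) (hf : Antitone f) (j : Fin n)
    (hj : r ≤ f j) :
    ∏ i, max r (f i) ≤ (r / t) ^ (n - 1 - (j : ℕ)) * ∏ i, max t (f i) := by
  have h1 : 1 ≤ r / t := (one_le_div ht).2 htr
  have hp : (r / t) ^ (n - 1 - (j : ℕ)) = ∏ i : Fin n, if j < i then r / t else 1 := by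
    rw [Finset.prod_ite, Finset.prod_const, Finset.prod_const_one, mul_one]
    congr 1
    rw [← Fin.card_Ioi]; congr 1; ext; simp
  rw [hp, ← Finset.prod_mul_distrib]
  refine Finset.prod_le_prod (fun i _ => (ht.le.trans htr).trans (le_max_left _ _)) ?_
  intro i _
  split_ifs with hij
  · refine max_le ?_ ?_
    · calc r = r / t * t := by field_simp
        _ ≤ _ := by gcongr; exact le_max_left _ _
    · calc f i ≤ max t (f i) := le_max_right _ _
        _ ≤ _ := le_mul_of_one_le_left (ht.le.trans (le_max_left _ _)) h1
  · have : f j ≤ f i := hf (not_lt.1 hij)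
    rw [one_mul]
    exact max_le ((hj.trans this).trans (le_max_right _ _)) (le_max_right _ _)

/-- The `n - j` factors from index `j` on equal `r` on one side and are at least `t` on the other,
so each contributes a full factor `t / r`. -/
theorem pow_mul_prod_max_le {r t : ℝ} (hr : 0 < r) (hrt : r ≤ t) (hf : Antitone f) (j : Fin n)
    (hj : f j ≤ r) :
    (t / r) ^ (n - (j : ℕ)) * ∏ i, max r (f i) ≤ ∏ i, max t (f i) := by
  have hp : (t / r) ^ (n - (j : ℕ)) = ∏ i : Fin n, if j ≤ i then t / r else 1 := by
    rw [Finset.prod_ite, Finset.prod_const, Finset.prod_const_one, mul_one]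
    congr 1
    rw [← Fin.card_Ici]; congr 1; ext; simp
  have ht := hr.trans_le hrt
  rw [hp, ← Finset.prod_mul_distrib]
  refine Finset.prod_le_prod (fun i _ => ?_) ?_
  · have : 0 ≤ max r (f i) := hr.le.trans (le_max_left _ _)
    split_ifs <;> positivity
  intro i _
  split_ifs with hij
  · rw [max_eq_left ((hf hij).trans hj)]
    calc t / r * r = t := by field_simp
      _ ≤ _ := le_max_left _ _
  · rw [one_mul]; exact max_le_max_right _ hrt

/-- `a i * t ^ i` is, for every `t > 0`, up to factors `2 ^ n` bounded above, and below for the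
maximising `i`, by `A * ∏ max t (f i)`. -/
structure TropicallyClose (A : ℝ) (f : Fin n → ℝ) (a : ℕ → ℝ) : Prop where
  pos : 0 < A
  anti : Antitone f
  term_le : ∀ t, 0 < t → ∀ i, a i * t ^ i ≤ 2 ^ n * (A * ∏ i, max t (f i))
  le_bound : ∀ t, 0 < t → ∀ B, (∀ i, a i * t ^ i ≤ B) → A * ∏ i, max t (f i) ≤ 2 ^ n * B

variable {A : ℝ} {a : ℕ → ℝ}

theorem prod_max_pos {t : ℝ} (ht : 0 < t) (f : Fin n → ℝ) : 0 < ∏ i, max t (f i) :=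
  Finset.prod_pos fun _ _ => ht.trans_le (le_max_left _ _)

theorem le_four_pow_of_pow_le {x : ℝ} (hx : 1 ≤ x) {k l : ℕ} (hkl : k < l)
    (h : x ^ l ≤ 4 ^ n * x ^ k) : x ≤ 4 ^ n := by
  have hk : 0 < x ^ k := by positivity
  have : x ^ (l - k) ≤ 4 ^ n := by
    rw [← Nat.sub_add_cancel hkl.le, pow_add] at h
    exact le_of_mul_le_mul_right h hk
  calc x = x ^ 1 := (pow_one x).symm
    _ ≤ x ^ (l - k) := pow_le_pow_right₀ hx (by omega)
    _ ≤ _ := this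

theorem two_pow_mul_two_pow (n : ℕ) : (2 : ℝ) ^ n * 2 ^ n = 4 ^ n := by
  rw [← mul_pow]; norm_num

/-- From `t` up to `f j` the monomial `V` gains `(f j / t) ^ V`, whereas the product gains at most
the power `n - 1 - j < V`. Since the two are comparable at both ends, the surplus power of `f j / t`
is at most `2 ^ n * 2 ^ n`. -/
theorem TropicallyClose.le_of_vertex (h : TropicallyClose A f a) (j : Fin n) {t : ℝ} (ht : 0 < t)
    {V : ℕ} (hV : n - (j : ℕ) ≤ V) (hpos : 0 < a V) (hmax : ∀ i, a i * t ^ i ≤ a V * t ^ V) :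
    f j ≤ 4 ^ n * t := by
  rcases le_or_gt (f j) t with hle | hlt
  · exact hle.trans (le_mul_of_one_le_left ht.le (one_le_pow₀ (by norm_num)))
  have hr : 0 < f j := ht.trans hlt
  have h1 := h.le_bound t ht _ hmax
  have h2 := h.term_le _ hr V
  have h3 := prod_max_le_pow_mul ht hlt.le h.anti j le_rfl
  have hx : 1 ≤ f j / t := (one_le_div ht).2 hlt.le
  rw [← div_le_iff₀ ht]
  have hj := j.2
  refine le_four_pow_of_pow_le hx (show n - 1 - (j : ℕ) < V by omega) ?_
  have hA := h.pos
  have hpos' : 0 < a V * t ^ V := by positivity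
  refine le_of_mul_le_mul_right ?_ hpos'
  calc (f j / t) ^ V * (a V * t ^ V) = a V * f j ^ V := by rw [div_pow]; field_simp
    _ ≤ _ := h2
    _ ≤ 2 ^ n * (A * ((f j / t) ^ (n - 1 - (j : ℕ)) * ∏ i, max t (f i))) := by gcongr
    _ = 2 ^ n * (f j / t) ^ (n - 1 - (j : ℕ)) * (A * ∏ i, max t (f i)) := by ring
    _ ≤ 2 ^ n * (f j / t) ^ (n - 1 - (j : ℕ)) * (2 ^ n * (a V * t ^ V)) := by gcongr
    _ = _ := by rw [← two_pow_mul_two_pow]; ring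

/-- This is the limiting case of the preceding bound, for roots at zero: if the lowest `V`
coefficients vanish, all monomials shrink at least like `t ^ V`, faster than a product whose `j`-th
factor is positive can. -/
theorem TropicallyClose.le_zero (h : TropicallyClose A f a) (j : Fin n)
    {V : ℕ} (hV : n - (j : ℕ) ≤ V) (hzero : ∀ i < V, a i = 0) (hnn : ∀ i, 0 ≤ a i) :
    f j ≤ 0 := by
  by_contra! hr
  set r := f j with hrdef
  -- Any `t` with `r / t > 4 ^ n` contradicts the bound on this ratio derived below.
  set t := r / (2 * 4 ^ n) with htdef
  have ht : 0 < t := by positivity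
  have hrt : r / t = 2 * 4 ^ n := by rw [htdef]; field_simp
  have h4 : (1 : ℝ) ≤ 4 ^ n := one_le_pow₀ (by norm_num)
  have hx : 1 ≤ r / t := by rw [hrt]; linarith
  have htr : t ≤ r := (one_le_div ht).1 hx
  have h3 := prod_max_le_pow_mul ht htr h.anti j hrdef.le
  have hA := h.pos
  have hG := prod_max_pos ht f
  have hGr := prod_max_pos hr f
  have h1 : A * ∏ i, max t (f i) ≤ 2 ^ n * ((t / r) ^ V * (2 ^ n * (A * ∏ i, max r (f i)))) := by
    refine h.le_bound t ht _ fun i => ?_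
    rcases lt_or_ge i V with hi | hi
    · rw [hzero i hi, zero_mul]; positivity
    · calc a i * t ^ i = (t / r) ^ i * (a i * r ^ i) := by
            rw [mul_left_comm, ← mul_pow, div_mul_cancel₀ t hr.ne']
        _ ≤ (t / r) ^ V * (a i * r ^ i) := by
          refine mul_le_mul_of_nonneg_right ?_ (mul_nonneg (hnn i) (by positivity))
          exact pow_le_pow_of_le_one (by positivity) ((div_le_one hr).2 htr) hi
        _ ≤ _ := mul_le_mul_of_nonneg_left (h.term_le r hr i) (by positivity)
  have hj := j.2
  have : r / t ≤ 4 ^ n := by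
    refine le_four_pow_of_pow_le hx (show n - 1 - (j : ℕ) < V by omega) ?_
    refine le_of_mul_le_mul_right ?_ (mul_pos hA hG)
    calc (r / t) ^ V * (A * ∏ i, max t (f i))
        ≤ (r / t) ^ V * (2 ^ n * ((t / r) ^ V * (2 ^ n * (A * ∏ i, max r (f i))))) := by gcongr
      _ = ((r / t) * (t / r)) ^ V * 4 ^ n * (A * ∏ i, max r (f i)) := by
          rw [← two_pow_mul_two_pow, mul_pow]; ring
      _ = 4 ^ n * (A * ∏ i, max r (f i)) := by
          have : r / t * (t / r) = 1 := by field_simp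
          rw [this]; ring
      _ ≤ 4 ^ n * (A * ((r / t) ^ (n - 1 - (j : ℕ)) * ∏ i, max t (f i))) := by gcongr
      _ = _ := by ring
  linarith

/-- The mirror image of `TropicallyClose.le_of_vertex`: going down from `t`, the product loses at
least the power `n - j`, and the monomial `U` only the smaller power `U`. -/
theorem TropicallyClose.ge_of_vertex (h : TropicallyClose A f a) (j : Fin n) {t : ℝ} (ht : 0 < t)
    {U : ℕ} (hU : U < n - (j : ℕ)) (hmax : ∀ i, a i * t ^ i ≤ a U * t ^ U) :
    t ≤ 4 ^ n * f j := by
  by_contra! hlt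
  -- The radius `f j` may be zero, and the comparison needs a positive lower end point; the second
  -- entry provides one that is still below `t / 4 ^ n`.
  set r := max (f j) (t / (2 * 4 ^ n)) with hrdef
  have h4 : (1 : ℝ) ≤ 4 ^ n := one_le_pow₀ (by norm_num)
  have hr : 0 < r := lt_max_of_lt_right (by positivity)
  have hrt : 4 ^ n * r < t := by
    rw [hrdef, mul_max_of_nonneg _ _ (by positivity)]
    refine max_lt hlt ?_
    have : 4 ^ n * (t / (2 * 4 ^ n)) = t / 2 := by field_simp
    rw [this]; linarith
  have hrt' : r ≤ t := (le_mul_of_one_le_left hr.le h4).trans hrt.le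
  have hx : 1 ≤ t / r := (one_le_div hr).2 hrt'
  have h3 := pow_mul_prod_max_le hr hrt' h.anti j (le_max_left _ _)
  have h1 := h.le_bound t ht _ hmax
  have h2 := h.term_le _ hr U
  have hA := h.pos
  have hG := prod_max_pos hr f
  have : t / r ≤ 4 ^ n := by
    refine le_four_pow_of_pow_le hx hU ?_
    refine le_of_mul_le_mul_right ?_ (mul_pos hA hG)
    calc (t / r) ^ (n - (j : ℕ)) * (A * ∏ i, max r (f i))
        = A * ((t / r) ^ (n - (j : ℕ)) * ∏ i, max r (f i)) := by ring
      _ ≤ A * ∏ i, max t (f i) := by gcongr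
      _ ≤ _ := h1
      _ = 2 ^ n * ((t / r) ^ U * (a U * r ^ U)) := by rw [div_pow]; field_simp
      _ ≤ 2 ^ n * ((t / r) ^ U * (2 ^ n * (A * ∏ i, max r (f i)))) := by gcongr
      _ = _ := by rw [← two_pow_mul_two_pow]; ring
  rw [div_le_iff₀ hr] at this
  linarith

end Comparison

/-! ### Powers of root radii in the abstract comparison -/

theorem rootRadius_antitone (p : Polynomial ℝ) : Antitone (rootRadius p) := by
  intro i j hij
  have h := (Multiset.pairwise_sort ((p.map (algebraMap ℝ ℂ)).roots.map fun x => ‖x‖)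
    (· ≥ ·))
  exact (List.sortedGE_iff_pairwise.2 h).antitone_get hij

theorem prod_rootRadius (p : Polynomial ℝ) (g : ℝ → ℝ) :
    ∏ j, g (rootRadius p j) = ((p.map (algebraMap ℝ ℂ)).roots.map fun x => g ‖x‖).prod := by
  have h1 : ((p.map (algebraMap ℝ ℂ)).roots.map fun x => g ‖x‖) =
      (((rootRadii p).map g : List ℝ) : Multiset ℝ) := by
    rw [← Multiset.map_coe, rootRadii, Multiset.sort_eq, Multiset.map_map]; rfl
  rw [h1, Multiset.prod_coe, ← Fin.prod_univ_getElem]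
  refine Fintype.prod_equiv (finCongr (by simp [length_rootRadii])) _ _ fun j => ?_
  simp [rootRadius]

theorem rootRadius_nonneg (p : Polynomial ℝ) (j : Fin p.natDegree) : 0 ≤ rootRadius p j := by
  have h : rootRadius p j ∈ rootRadii p := List.get_mem _ _
  rw [rootRadii, Multiset.mem_sort, Multiset.mem_map] at h
  obtain ⟨x, _, hx⟩ := h
  exact hx ▸ norm_nonneg x

/-- The coefficients of a polynomial whose roots are the `M`-th powers of those of `p`. -/
theorem tropicallyClose_of_roots_eq {p q : Polynomial ℝ} {M : ℕ} (hq : q ≠ 0)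
    (hdeg : q.natDegree = p.natDegree)
    (hroots : (q.map (algebraMap ℝ ℂ)).roots = (p.map (algebraMap ℝ ℂ)).roots.map (· ^ M)) :
    TropicallyClose |q.leadingCoeff| (fun j => rootRadius p j ^ M) fun i => |q.coeff i| := by
  have hprod (t : ℝ) : ((q.map (algebraMap ℝ ℂ)).roots.map fun x => max t ‖x‖).prod =
      ∏ j, max t (rootRadius p j ^ M) := by
    rw [prod_rootRadius p fun x => max t (x ^ M), hroots, Multiset.map_map]
    simp
  refine ⟨by simpa using hq, ?_, ?_, ?_⟩
  · intro i j hij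
    exact pow_le_pow_left₀ (rootRadius_nonneg p j) (rootRadius_antitone p hij) _
  · intro t ht i
    rw [← hprod, ← hdeg]
    exact abs_coeff_mul_pow_le q ht i
  · intro t ht B hB
    rw [← hprod, ← hdeg]
    exact leadingCoeff_mul_prod_max_le q ht hB

/-! ### Cost and correctness of programs, taken together -/

namespace RealRAM

/-- Started in `s`, the program `P` executes at most `C` instructions and ends in a state with the
property `Q`. -/
def Prog.Meets (P : Prog) (s : State) (C : ℕ) (Q : State → Prop) : Prop :=
  P.cost s ≤ C ∧ Q (P.run s)

theorem Prog.Meets.mono {P : Prog} {s : State} {C C' : ℕ} {Q Q' : State → Prop}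
    (h : P.Meets s C Q) (hC : C ≤ C') (hQ : ∀ s', Q s' → Q' s') : P.Meets s C' Q' :=
  ⟨h.1.trans hC, hQ _ h.2⟩

theorem Prog.Meets.seq {P P' : Prog} {s : State} {C C' : ℕ} {Q Q' : State → Prop}
    (h : P.Meets s C Q) (h' : ∀ s', Q s' → P'.Meets s' C' Q') :
    (Prog.seq P P').Meets s (C + C') Q' :=
  ⟨Nat.add_le_add h.1 (h' _ h.2).1, (h' _ h.2).2⟩

theorem Prog.Meets.loop {P : Prog} {s : State} {e : NatExpr} {m C : ℕ} (I : ℕ → State → Prop)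
    (he : e.eval s = m) (h0 : I 0 s) (hstep : ∀ i < m, ∀ s', I i s' → P.Meets s' C (I (i + 1))) :
    (Prog.loop e P).Meets s (1 + m * (1 + C)) (I m) := by
  have hI : ∀ i ≤ m, I i (P.run^[i] s) := by
    intro i
    induction i with
    | zero => intro _; exact h0
    | succ i ih =>
      intro hi
      rw [Function.iterate_succ_apply']
      exact (hstep i hi _ (ih (by omega))).2
  refine ⟨?_, ?_⟩
  · rw [Prog.cost, he]
    gcongr
    calc _ ≤ ∑ _i ∈ Finset.range m, (1 + C) := by
          refine Finset.sum_le_sum fun i hi => ?_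
          have hi := Finset.mem_range.1 hi
          exact Nat.add_le_add_left (hstep i hi _ (hI i hi.le)).1 1
      _ = _ := by simp
  · rw [Prog.run, he]; exact hI m le_rfl

/-- The content of the natural number cell `k`. -/
abbrev NatExpr.cell (k : ℕ) : NatExpr := .load (.lit k)

/-- Execute `P` for the values `0, 1, …, e - 1` of the natural number cell `4`. -/
def Prog.forUpTo (e : NatExpr) (P : Prog) : Prog :=
  .seq (.setNat (.lit 4) (.lit 0))
    (.loop e (.seq P (.setNat (.lit 4) (.add (.cell 4) (.lit 1)))))

theorem Prog.Meets.forUpTo {P : Prog} {s : State} {e : NatExpr} {m C : ℕ} (I : ℕ → State → Prop)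
    (he : e.eval (s.storeNat 4 0) = m) (h0 : I 0 (s.storeNat 4 0))
    (hstep : ∀ i < m, ∀ s', s'.nats 4 = i → I i s' →
      P.Meets s' C fun s'' => s''.nats 4 = i ∧ I (i + 1) (s''.storeNat 4 (i + 1))) :
    (Prog.forUpTo e P).Meets s (2 + m * (2 + C)) (I m) := by
  have h : (Prog.loop e (.seq P (.setNat (.lit 4) (.add (.cell 4) (.lit 1))))).Meets
      (s.storeNat 4 0) (1 + m * (1 + (C + 1))) (fun s' => s'.nats 4 = m ∧ I m s') := by
    refine Prog.Meets.loop (fun i s' => s'.nats 4 = i ∧ I i s') he ⟨by simp [State.storeNat], h0⟩ ?_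
    rintro i hi s' ⟨h4, hI⟩
    refine (hstep i hi s' h4 hI).seq ?_
    rintro s'' ⟨h4', hI'⟩
    refine ⟨le_rfl, ?_⟩
    simp only [Prog.run, NatExpr.eval, h4']
    exact ⟨by simp [State.storeNat], hI'⟩
  refine ⟨?_, h.2.2⟩
  have := h.1
  simp only [Prog.forUpTo, Prog.cost, Prog.run, NatExpr.eval] at this ⊢
  linarith

end RealRAM

/-! ### The discrete Fourier transform -/

/-- An intermediate stage, with stride `h`, of the fast Fourier transform of length `N`. -/
noncomputable def stridedDFT (N h : ℕ) (ω : ℂ) (a : ℕ → ℂ) (x : ℕ) : ℂ :=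
  ∑ i ∈ Finset.range (N / h), a (x % h + i * h) * ω ^ (i * (x - x % h))

/-- The discrete Fourier transform of length `N`. -/
noncomputable def dft (N : ℕ) (ω : ℂ) (a : ℕ → ℂ) (x : ℕ) : ℂ :=
  ∑ i ∈ Finset.range N, a i * ω ^ (i * x)

theorem stridedDFT_self {N : ℕ} (ω : ℂ) (a : ℕ → ℂ) {x : ℕ} (hx : x < N) :
    stridedDFT N N ω a x = a x := by
  simp [stridedDFT, Nat.div_self (by omega : 0 < N), Nat.mod_eq_of_lt hx]

theorem stridedDFT_one (N : ℕ) (ω : ℂ) (a : ℕ → ℂ) (x : ℕ) :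
    stridedDFT N 1 ω a x = dft N ω a x := by
  simp [stridedDFT, dft, Nat.mod_one]

theorem sum_range_two_mul {M : Type*} [AddCommMonoid M] (f : ℕ → M) (q : ℕ) :
    ∑ i ∈ Finset.range (2 * q), f i =
      ∑ i ∈ Finset.range q, f (2 * i) + ∑ i ∈ Finset.range q, f (2 * i + 1) := by
  induction q with
  | zero => simp
  | succ q ih =>
    rw [Nat.mul_succ, Finset.sum_range_succ, Finset.sum_range_succ, ih, Finset.sum_range_succ,
      Finset.sum_range_succ]
    abel

/-- With `x = h * k + b`, the entry is the transform of the subsequence `a (b + i * h)` at frequency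
`k`. Even and odd `i` give subsequences of stride `2 * h` with residues `b` and `b + h`, and their
frequency matters only modulo `N / (2 * h)`, which is the reduction modulo `N` in the index. -/
theorem stridedDFT_halve {N h : ℕ} (hh : 0 < h) (hN : 2 * h ∣ N) {ω : ℂ} (hω : ω ^ N = 1)
    (a : ℕ → ℂ) (x : ℕ) :
    stridedDFT N h ω a x =
      stridedDFT N (2 * h) ω a (2 * (x - x % h) % N + x % h) +
        ω ^ (x - x % h) * stridedDFT N (2 * h) ω a (2 * (x - x % h) % N + x % h + h) := by
  obtain ⟨q, rfl⟩ := hN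
  have hb := Nat.mod_lt x hh
  have he : x - x % h = h * (x / h) := by
    have := Nat.mod_add_div x h; omega
  set b := x % h
  rw [he]
  set k := x / h
  have h2 : 2 * (h * k) % (2 * h * q) = 2 * h * (k % q) := by
    rw [← mul_assoc, Nat.mul_mod_mul_left]
  have m1 : (2 * h * (k % q) + b) % (2 * h) = b := by
    rw [Nat.mul_add_mod, Nat.mod_eq_of_lt (by omega)]
  have m2 : (2 * h * (k % q) + b + h) % (2 * h) = b + h := by
    rw [add_assoc, Nat.mul_add_mod, Nat.mod_eq_of_lt (by omega)]
  have d1 : 2 * h * q / h = 2 * q := by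
    rw [mul_comm 2 h, mul_assoc, Nat.mul_div_cancel_left _ hh]
  have d2 : 2 * h * q / (2 * h) = q := Nat.mul_div_cancel_left _ (by omega)
  have hpow (i : ℕ) : ω ^ (i * (2 * (h * k))) = ω ^ (i * (2 * h * (k % q))) := by
    rw [← h2, mul_comm i, mul_comm i, pow_mul _ _ i, pow_mul _ _ i, ← pow_eq_pow_mod _ hω]
  have hb' : x % h = b := rfl
  rw [stridedDFT, stridedDFT, stridedDFT, h2, m1, m2, d1, d2, sum_range_two_mul, hb', he,
    Finset.mul_sum]
  have s1 : 2 * h * (k % q) + b - b = 2 * h * (k % q) := by omega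
  have s2 : 2 * h * (k % q) + b + h - (b + h) = 2 * h * (k % q) := by omega
  rw [s1, s2]
  congr 1
  · refine Finset.sum_congr rfl fun i _ => ?_
    rw [← hpow]; congr 2 <;> ring
  · refine Finset.sum_congr rfl fun i _ => ?_
    rw [← hpow, mul_left_comm (ω ^ (h * k)), ← pow_add]; congr 2 <;> ring

/-- By orthogonality of characters, transforming twice reverses the indices and multiplies by `N`;
no separate inverse transform is needed. -/
theorem dft_dft {N : ℕ} {ω : ℂ} (hω : IsPrimitiveRoot ω N) (a : ℕ → ℂ) {m : ℕ} (hm : m < N) :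
    dft N ω (dft N ω a) ((N - m) % N) = N * a m := by
  unfold dft
  simp_rw [Finset.sum_mul]
  rw [Finset.sum_comm]
  have key (l : ℕ) (hl : l < N) : ∑ x ∈ Finset.range N, a l * ω ^ (l * x) *
      ω ^ (x * ((N - m) % N)) = if l = m then N * a m else 0 := by
    have h1 (x : ℕ) : a l * ω ^ (l * x) * ω ^ (x * ((N - m) % N)) =
        a l * (ω ^ (l + (N - m))) ^ x := by
      have : ω ^ (x * ((N - m) % N)) = ω ^ (x * (N - m)) := by
        rw [mul_comm x, mul_comm x, pow_mul, pow_mul,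
          ← pow_eq_pow_mod _ hω.pow_eq_one]
      rw [this, mul_assoc, ← pow_add, ← pow_mul]; congr 2; ring
    simp_rw [h1]
    rw [← Finset.mul_sum]
    split_ifs with hlm
    · subst hlm
      rw [show l + (N - l) = N by omega, hω.pow_eq_one]; simp [mul_comm]
    · have hne : ω ^ (l + (N - m)) ≠ 1 := by
        rw [Ne, hω.pow_eq_one_iff_dvd]
        -- The exponent lies strictly between `0` and `2 * N` and differs from `N`, so `N` cannot
        -- divide it.
        rintro ⟨c, hc⟩
        rcases Nat.lt_or_ge c 2 with h | h
        · interval_cases c <;> omega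
        · have := Nat.mul_le_mul_left N h
          omega
      have : ∑ i ∈ Finset.range N, (ω ^ (l + (N - m))) ^ i = 0 := by
        rw [geom_sum_eq hne, ← pow_mul, mul_comm, pow_mul, hω.pow_eq_one]; simp
      rw [this, mul_zero]
  rw [Finset.sum_congr rfl fun l hl => key l (Finset.mem_range.1 hl)]
  rw [Finset.sum_ite_eq' _ _ (fun _ => (N : ℂ) * a m), if_pos (Finset.mem_range.2 hm)]

theorem isPrimitiveRoot_of_pow_eq_neg_one {ω : ℂ} {l : ℕ} (h : ω ^ 2 ^ l = -1) :
    IsPrimitiveRoot ω (2 ^ (l + 1)) := by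
  have : orderOf ω = 2 ^ (l + 1) := by
    refine orderOf_eq_prime_pow ?_ ?_
    · rw [h]; norm_num
    · rw [pow_succ, pow_mul, h]; norm_num
  exact this ▸ IsPrimitiveRoot.orderOf ω

open Polynomial in
theorem dft_coeff {N : ℕ} (ω : ℂ) {f : ℂ[X]} (hf : f.natDegree < N) (x : ℕ) :
    dft N ω f.coeff x = f.eval (ω ^ x) := by
  rw [dft, eval_eq_sum_range' hf]
  refine Finset.sum_congr rfl fun i _ => ?_
  rw [← pow_mul, mul_comm x]

theorem dft_congr {N : ℕ} {ω : ℂ} {a b : ℕ → ℂ} (h : ∀ i < N, a i = b i) (x : ℕ) :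
    dft N ω a x = dft N ω b x :=
  Finset.sum_congr rfl fun i hi => by rw [h i (Finset.mem_range.1 hi)]

-- Because `ω ^ 2 ^ l = -1`, shifting the index by half the length turns the value at `ω ^ x` into
-- the value at `-ω ^ x`. One transform thus gives the values of both factors, and the degree
-- condition excludes wrap-around in the product.
open Polynomial in
theorem dft_mul_dft_half {l : ℕ} {ω : ℂ} (hω : ω ^ 2 ^ l = -1) {f : ℂ[X]}
    (hf : 2 * f.natDegree < 2 ^ (l + 1)) {i : ℕ} (hi : 2 * i < 2 ^ (l + 1)) :
    dft (2 ^ (l + 1)) ω (fun x => dft (2 ^ (l + 1)) ω f.coeff x *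
        dft (2 ^ (l + 1)) ω f.coeff ((x + 2 ^ l) % 2 ^ (l + 1)))
      ((2 ^ (l + 1) - 2 * i) % 2 ^ (l + 1)) =
      ((2 ^ (l + 1) : ℕ) : ℂ) * (f * f.comp (-X)).coeff (2 * i) := by
  have hprim := isPrimitiveRoot_of_pow_eq_neg_one hω
  rw [← dft_dft hprim _ hi]
  refine dft_congr (fun x _ => ?_) _
  rw [dft_coeff _ (by omega), dft_coeff _ (by omega), dft_coeff, eval_mul, eval_comp,
    ← pow_eq_pow_mod _ hprim.pow_eq_one, pow_add, hω]
  · simp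
  · refine natDegree_mul_le.trans_lt ?_
    rw [natDegree_comp, natDegree_neg, natDegree_X]
    omega

/-! ### Complex arrays in memory and the butterfly step -/

namespace RealRAM

theorem State.storeNat_nats (s : State) (i v : ℕ) :
    (s.storeNat i v).nats = Function.update s.nats i v := rfl

theorem State.storeNat_reals (s : State) (i v : ℕ) : (s.storeNat i v).reals = s.reals := rfl

theorem State.storeReal_nats (s : State) (i : ℕ) (v : ℝ) : (s.storeReal i v).nats = s.nats := rfl

theorem State.storeReal_reals (s : State) (i : ℕ) (v : ℝ) :
    (s.storeReal i v).reals = Function.update s.reals i v := rfl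

theorem NatExpr.eval_congr {s s' : State} (h : s'.nats = s.nats) (e : NatExpr) :
    e.eval s' = e.eval s := by
  induction e with
  | lit k => rfl
  | load a ih => simp only [NatExpr.eval, ih, h]
  | _ a b iha ihb => simp only [NatExpr.eval, iha, ihb]

theorem NatExpr.eval_storeReal (s : State) (i : ℕ) (v : ℝ) (e : NatExpr) :
    e.eval (s.storeReal i v) = e.eval s :=
  NatExpr.eval_congr (State.storeReal_nats s i v) e

/-- Complex multiplication, `sc` being a scratch cell. -/
def Prog.cmul (dr di xr xi yr yi sc : NatExpr) : Prog :=
  .seq (.arith .mul dr xr yr) <| .seq (.arith .mul sc xi yi) <| .seq (.arith .sub dr dr sc) <|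
  .seq (.arith .mul di xr yi) <| .seq (.arith .mul sc xi yr) <| .arith .add di di sc

theorem Prog.cost_cmul (dr di xr xi yr yi sc : NatExpr) (s : State) :
    (Prog.cmul dr di xr xi yr yi sc).cost s = 6 := by
  simp [Prog.cmul, Prog.cost]

theorem Prog.run_cmul (dr di xr xi yr yi sc : NatExpr) (s : State)
    (hd : dr.eval s ≠ di.eval s)
    (hr : ∀ e ∈ [xr, xi, yr, yi, sc], dr.eval s ≠ e.eval s)
    (hi : ∀ e ∈ [xr, xi, yr, yi, sc], di.eval s ≠ e.eval s)
    (hs : ∀ e ∈ [xr, xi, yr, yi], sc.eval s ≠ e.eval s) :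
    (Prog.cmul dr di xr xi yr yi sc).run s =
      ((s.storeReal (sc.eval s) (s.reals (xi.eval s) * s.reals (yr.eval s))).storeReal (dr.eval s)
        (s.reals (xr.eval s) * s.reals (yr.eval s) -
          s.reals (xi.eval s) * s.reals (yi.eval s))).storeReal (di.eval s)
        (s.reals (xr.eval s) * s.reals (yi.eval s) +
          s.reals (xi.eval s) * s.reals (yr.eval s)) := by
  simp only [List.mem_cons, List.not_mem_nil, or_false, forall_eq_or_imp, forall_eq] at hr hi hs
  obtain ⟨r1, r2, r3, r4, r5⟩ := hr
  obtain ⟨i1, i2, i3, i4, i5⟩ := hi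
  obtain ⟨s1, s2, s3, s4⟩ := hs
  simp only [Prog.cmul, Prog.run, NatExpr.eval_storeReal, State.storeReal_reals, ArithOp.eval]
  refine State.ext rfl ?_
  ext x
  simp only [State.storeReal_reals, Function.update_apply, r1.symm, r2.symm, r3.symm, r4.symm,
    r5.symm, i2.symm, i3.symm, i5.symm, s1.symm, s2.symm, s3.symm, s4.symm,
    hd.symm, r5, i5, if_true, if_false]
  split_ifs <;> first | rfl | (exfalso; omega)

/-- Cell `i` of the `k`-th array of real numbers, each array having the length in cell `1`. -/
abbrev NatExpr.arr (k : ℕ) (i : NatExpr) : NatExpr := .add (.mul (.lit k) (.cell 1)) i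

/-- Entry `i` of the complex array that consists of the `k`-th and the `k + 1`-st array of real
numbers, of length `N` each. -/
def State.cplx (s : State) (N k i : ℕ) : ℂ := ⟨s.reals (k * N + i), s.reals ((k + 1) * N + i)⟩

/-- Compute the entries of the complex array `3` by `P` and move them to the complex array `1`. -/
def Prog.mapArray (P : Prog) : Prog :=
  .seq (.forUpTo (.cell 1) P) <| .forUpTo (.cell 1) <|
    .seq (.copy (.arr 1 (.cell 4)) (.arr 3 (.cell 4))) (.copy (.arr 2 (.cell 4)) (.arr 4 (.cell 4)))

/-- The parameters and all arrays before the array `7`, but for the arrays `3` and `4`, agree. -/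
structure AgreeOffArray (N : ℕ) (s s' : State) : Prop where
  nats : ∀ k, k < 4 ∨ k = 5 → s'.nats k = s.nats k
  reals : ∀ x, x < 3 * N ∨ 5 * N ≤ x ∧ x < 7 * N → s'.reals x = s.reals x

/-- The parameters, the array `0` and the complex array `5` agree. -/
structure Frame (N : ℕ) (s s' : State) : Prop where
  nats : ∀ k, k < 4 → s'.nats k = s.nats k
  reals : ∀ x, x < N ∨ 5 * N ≤ x ∧ x < 7 * N → s'.reals x = s.reals x

theorem Frame.trans {N : ℕ} {s s' s'' : State} (h : Frame N s s') (h' : Frame N s' s'') :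
    Frame N s s'' :=
  ⟨fun k hk => (h'.nats k hk).trans (h.nats k hk), fun x hx => (h'.reals x hx).trans (h.reals x hx)⟩

/-- New entries go to separate storage and are copied back at the end, so each run of `P` still sees
the old complex array `1`. Cell `5` is preserved because it holds the stride during the Fourier
transform. -/
theorem Prog.meets_mapArray {P : Prog} {s : State} {N C : ℕ} {F : ℕ → ℂ} (hN : s.nats 1 = N)
    (hP : ∀ i < N, ∀ s', s'.nats 4 = i → AgreeOffArray N s s' → P.Meets s' C fun s'' =>
      s''.nats 4 = i ∧ (∀ k, k < 4 ∨ k = 5 → s''.nats k = s'.nats k) ∧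
      (∀ x, x ≠ 3 * N + i → x ≠ 4 * N + i → x < 7 * N → s''.reals x = s'.reals x) ∧
      s''.cplx N 3 i = F i) :
    (Prog.mapArray P).Meets s (4 + N * (6 + C)) fun s' =>
      Frame N s s' ∧ s'.nats 5 = s.nats 5 ∧ ∀ i < N, s'.cplx N 1 i = F i := by
  have h1 : (Prog.forUpTo (.cell 1) P).Meets s (2 + N * (2 + C)) fun s' =>
      AgreeOffArray N s s' ∧ ∀ i < N, s'.cplx N 3 i = F i := by
    refine Prog.Meets.forUpTo
      (fun m s' => AgreeOffArray N s s' ∧ ∀ i < m, s'.cplx N 3 i = F i) ?_ ?_ ?_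
    · simp [NatExpr.eval, State.storeNat, hN]
    · refine ⟨⟨fun k hk => ?_, fun x _ => rfl⟩, fun i hi => absurd hi (by omega)⟩
      rw [State.storeNat_nats, Function.update_of_ne (by omega)]
    · rintro i hi s' h4 ⟨hag, hF⟩
      refine (hP i hi s' h4 hag).mono le_rfl ?_
      rintro s'' ⟨h4', hn, hr, hB⟩
      refine ⟨h4', ⟨fun k hk => ?_, fun x hx => ?_⟩, fun j hj => ?_⟩
      · rw [State.storeNat_nats, Function.update_of_ne (by omega), hn k hk, hag.nats k hk]
      · rw [State.storeNat_reals, hr x (by omega) (by omega) (by omega), hag.reals x hx]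
      · rcases Nat.lt_succ_iff_lt_or_eq.1 hj with hj | rfl
        · rw [← hF j hj]
          simp only [State.cplx, State.storeNat_reals]
          rw [hr _ (by omega) (by omega) (by omega), hr _ (by omega) (by omega) (by omega)]
        · exact hB
  refine (h1.seq (C' := 2 + N * (2 + 2)) ?_).mono (by nlinarith) fun s' h => h
  rintro s1 ⟨hag, hF⟩
  have hN1 : s1.nats 1 = N := by rw [hag.nats 1 (by omega), hN]
  refine (Prog.Meets.forUpTo (m := N) (C := 2) (fun m s' =>
      (∀ k, k < 4 ∨ k = 5 → s'.nats k = s.nats k) ∧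
      (∀ x, x < N ∨ 3 * N ≤ x → s'.reals x = s1.reals x) ∧
      ∀ i < m, s'.cplx N 1 i = F i) ?_ ?_ ?_).mono le_rfl ?_
  · simp [NatExpr.eval, State.storeNat, hN1]
  · refine ⟨fun k hk => ?_, fun x _ => rfl, fun i hi => absurd hi (by omega)⟩
    rw [State.storeNat_nats, Function.update_of_ne (by omega), hag.nats k hk]
  · rintro i hi s' h4 ⟨hn, hr, hA⟩
    have hN' : s'.nats 1 = N := by rw [hn 1 (by omega), hN]
    refine ⟨by simp [Prog.cost], ?_⟩
    simp only [Prog.run, NatExpr.eval, State.storeReal_nats, State.storeReal_reals, h4, hN']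
    refine ⟨trivial, fun k hk => ?_, fun x hx => ?_, fun j hj => ?_⟩
    · rw [State.storeNat_nats, Function.update_of_ne (by omega)]
      exact hn k hk
    · simp only [State.storeNat_reals, State.storeReal_reals]
      rw [Function.update_of_ne (by omega), Function.update_of_ne (by omega), hr x hx]
    · simp only [State.cplx, State.storeNat_reals, State.storeReal_reals]
      rcases Nat.lt_succ_iff_lt_or_eq.1 hj with hj | rfl
      · rw [← hA j hj]
        simp (disch := omega) only [State.cplx, Function.update_of_ne]
      · rw [← hF j hi]
        simp (disch := omega) only [State.cplx, Function.update_of_ne, Function.update_self]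
        rw [hr _ (by omega), hr _ (by omega)]
  · rintro s' ⟨hn, hr, hA⟩
    refine ⟨⟨fun k hk => hn k (by omega), fun x hx => ?_⟩, hn 5 (by omega), hA⟩
    rw [hr x (by omega), hag.reals x (by omega)]

/-- One entry of one stage of the fast Fourier transform; cell `5` holds the new stride. -/
def Prog.butterfly : Prog :=
  .seq (.setNat (.lit 6) (.mod (.cell 4) (.cell 5))) <|
  .seq (.setNat (.lit 7) (.sub (.cell 4) (.cell 6))) <|
  .seq (.setNat (.lit 6) (.add (.mod (.mul (.lit 2) (.cell 7)) (.cell 1)) (.cell 6))) <|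
  .seq (.cmul (.arr 3 (.cell 4)) (.arr 4 (.cell 4)) (.arr 5 (.cell 7)) (.arr 6 (.cell 7))
    (.arr 1 (.add (.cell 6) (.cell 5))) (.arr 2 (.add (.cell 6) (.cell 5))) (.arr 7 (.lit 0))) <|
  .seq (.arith .add (.arr 3 (.cell 4)) (.arr 3 (.cell 4)) (.arr 1 (.cell 6)))
    (.arith .add (.arr 4 (.cell 4)) (.arr 4 (.cell 4)) (.arr 2 (.cell 6)))

theorem two_mul_mod_add_lt {N h x : ℕ} (hh : 0 < h) (hN : 2 * h ∣ N) (hx : x < N) :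
    2 * (x - x % h) % N + x % h + h < N := by
  obtain ⟨q, rfl⟩ := hN
  have hb := Nat.mod_lt x hh
  have he : x - x % h = h * (x / h) := by
    have := Nat.mod_add_div x h; omega
  have hq : 0 < q := by
    rcases Nat.eq_zero_or_pos q with rfl | hq
    · omega
    · exact hq
  have h2 : 2 * (x - x % h) % (2 * h * q) = 2 * h * (x / h % q) := by
    rw [he, ← mul_assoc, Nat.mul_mod_mul_left]
  rw [h2]
  have h3 : x / h % q + 1 ≤ q := Nat.mod_lt _ hq
  have := Nat.mul_le_mul_left (2 * h) h3
  rw [mul_add] at this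
  omega

theorem Prog.meets_butterfly {s : State} {N h i : ℕ} (hN : s.nats 1 = N) (h4 : s.nats 4 = i)
    (h5 : s.nats 5 = h) (hh : 0 < h) (hdvd : 2 * h ∣ N) (hi : i < N) :
    Prog.butterfly.Meets s 11 fun s' =>
      s'.nats 4 = i ∧ (∀ k, k < 4 ∨ k = 5 → s'.nats k = s.nats k) ∧
      (∀ x, x ≠ 3 * N + i → x ≠ 4 * N + i → x < 7 * N → s'.reals x = s.reals x) ∧
      s'.cplx N 3 i = s.cplx N 1 (2 * (i - i % h) % N + i % h) +
        s.cplx N 5 (i - i % h) * s.cplx N 1 (2 * (i - i % h) % N + i % h + h) := by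
  have hlt := two_mul_mod_add_lt hh hdvd hi
  refine ⟨by simp [Prog.butterfly, Prog.cost, Prog.cost_cmul], ?_⟩
  simp (disch := omega) only [Prog.butterfly, Prog.run, NatExpr.eval, State.storeNat_nats,
    Function.update_of_ne, Function.update_self, h4, h5, hN]
  set e := i - i % h with he
  set y := 2 * e % N + i % h with hy
  set s1 := ((s.storeNat 6 (i % h)).storeNat 7 e).storeNat 6 y with hs1
  have n1 : s1.nats 1 = N := by simp [hs1, State.storeNat, hN]
  have n4 : s1.nats 4 = i := by simp [hs1, State.storeNat, h4]
  have n5 : s1.nats 5 = h := by simp [hs1, State.storeNat, h5]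
  have n6 : s1.nats 6 = y := by simp [hs1, State.storeNat]
  have n7 : s1.nats 7 = e := by simp [hs1, State.storeNat]
  have hr : s1.reals = s.reals := rfl
  have hk : ∀ k, k < 4 ∨ k = 5 → s1.nats k = s.nats k := by
    intro k hk
    simp (disch := omega) only [hs1, State.storeNat_nats, Function.update_of_ne]
  have hei : e ≤ i := Nat.sub_le _ _
  clear_value s1 e y
  rw [Prog.run_cmul]
  · simp only [NatExpr.eval, State.storeReal_nats, State.storeReal_reals, ArithOp.eval,
      n1, n4, n5, n6, n7, hr]
    refine ⟨trivial, hk, fun x hx1 hx2 hx3 => ?_, ?_⟩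
    · simp (disch := omega) only [Function.update_of_ne]
    · simp (disch := omega) only [State.cplx, State.storeReal_reals, Function.update_of_ne,
        Function.update_self, hr]
      apply Complex.ext
      · simp only [Complex.add_re, Complex.mul_re, ← add_assoc]; ring
      · simp only [Complex.add_im, Complex.mul_im, ← add_assoc]; ring
  · simp only [NatExpr.eval, n1, n4]; omega
  all_goals
    simp only [List.mem_cons, List.not_mem_nil, or_false, forall_eq_or_imp, forall_eq,
      NatExpr.eval, n1, n4, n5, n6, n7]
    omega

end RealRAM

/-! ### Fast Fourier transform and root squaring as programs -/

namespace RealRAM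

/-- The fast Fourier transform of the complex array `1`. -/
def Prog.fft : Prog :=
  .seq (.setNat (.lit 5) (.cell 1)) <|
  .loop (.cell 2) (.seq (.setNat (.lit 5) (.div (.cell 5) (.lit 2))) (.mapArray .butterfly))

/-- Cells `1` and `2` hold `2 ^ L` and `L`, the complex array `5` holds the powers of `ω`. -/
structure FFTReady (L : ℕ) (ω : ℂ) (s : State) : Prop where
  length : s.nats 1 = 2 ^ L
  log : s.nats 2 = L
  table : ∀ i < 2 ^ L, s.cplx (2 ^ L) 5 i = ω ^ i

theorem FFTReady.of_frame {L : ℕ} {ω : ℂ} {s s' : State} (h : FFTReady L ω s)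
    (hf : Frame (2 ^ L) s s') : FFTReady L ω s' := by
  refine ⟨by rw [hf.nats 1 (by omega), h.length], by rw [hf.nats 2 (by omega), h.log], ?_⟩
  intro i hi
  rw [← h.table i hi, State.cplx, State.cplx, hf.reals _ (by omega), hf.reals _ (by omega)]

theorem Frame.refl (N : ℕ) (s : State) : Frame N s s := ⟨fun _ _ => rfl, fun _ _ => rfl⟩

theorem Frame.storeNat {N : ℕ} {s s' : State} (h : Frame N s s') {k : ℕ} (hk : 4 ≤ k) (v : ℕ) :
    Frame N s (s'.storeNat k v) := by
  refine ⟨fun j hj => ?_, fun x hx => h.reals x hx⟩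
  rw [State.storeNat_nats, Function.update_of_ne (by omega), h.nats j hj]

theorem Prog.meets_fft {s : State} {L : ℕ} {ω : ℂ} (hs : FFTReady L ω s) (hω : ω ^ 2 ^ L = 1) :
    Prog.fft.Meets s (2 + L * (6 + 17 * 2 ^ L)) fun s' =>
      Frame (2 ^ L) s s' ∧
        ∀ i < 2 ^ L, s'.cplx (2 ^ L) 1 i = dft (2 ^ L) ω (s.cplx (2 ^ L) 1) i := by
  set N := 2 ^ L with hN
  have h1 : (Prog.setNat (.lit 5) (.cell 1)).Meets s 1 fun s' => s' = s.storeNat 5 N := by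
    refine ⟨le_rfl, ?_⟩
    simp only [Prog.run, NatExpr.eval, hs.length, hN]
  refine (h1.seq (C' := 1 + L * (1 + (1 + (4 + N * (6 + 11))))) ?_).mono
    (by ring_nf; rfl) fun _ h => h
  rintro _ rfl
  refine (Prog.Meets.loop (m := L) (fun m s' => Frame N s s' ∧ s'.nats 5 = 2 ^ (L - m) ∧
    ∀ i < N, s'.cplx N 1 i = stridedDFT N (2 ^ (L - m)) ω (s.cplx N 1) i) ?_ ?_ ?_).mono le_rfl ?_
  · simp [NatExpr.eval, State.storeNat_nats, hs.log]
  · refine ⟨(Frame.refl N s).storeNat (by omega) N, ?_, fun i hi => ?_⟩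
    · rw [State.storeNat_nats, Function.update_self, hN, Nat.sub_zero]
    · rw [Nat.sub_zero, ← hN, stridedDFT_self _ _ hi]; rfl
  · rintro m hm s' ⟨hf, h5, hA⟩
    set h := 2 ^ (L - (m + 1)) with hh
    have h2 : 2 ^ (L - m) = 2 * h := by
      rw [hh, ← pow_succ', show L - m = L - (m + 1) + 1 by omega]
    have hpos : 0 < h := by positivity
    have hdvd : 2 * h ∣ N := by
      rw [← h2]; exact pow_dvd_pow 2 (by omega)
    rw [h2] at h5 hA
    have h3 : (Prog.setNat (.lit 5) (.div (.cell 5) (.lit 2))).Meets s' 1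
        fun s'' => s'' = s'.storeNat 5 h := by
      refine ⟨le_rfl, ?_⟩
      simp only [Prog.run, NatExpr.eval, h5]
      rw [Nat.mul_div_cancel_left _ (by norm_num)]
    refine h3.seq ?_
    rintro _ rfl
    have hf' := hf.storeNat (k := 5) (by omega) h
    have hr' := hs.of_frame hf'
    refine (Prog.meets_mapArray (F := stridedDFT N h ω (s.cplx N 1)) hr'.length ?_).mono le_rfl ?_
    · intro i hi t h4 hag
      have ht5 : t.nats 5 = h := by
        rw [hag.nats 5 (by omega), State.storeNat_nats, Function.update_self]
      have hlt := two_mul_mod_add_lt hpos hdvd hi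
      refine (Prog.meets_butterfly (by rw [hag.nats 1 (by omega), hr'.length]) h4 ht5 hpos hdvd
        hi).mono le_rfl ?_
      rintro t' ⟨p1, p2, p3, p4⟩
      refine ⟨p1, p2, p3, ?_⟩
      have hA' (j : ℕ) (hj : j < N) : t.cplx N 1 j = stridedDFT N (2 * h) ω (s.cplx N 1) j := by
        rw [← hA j hj, State.cplx, hag.reals _ (by omega), hag.reals _ (by omega)]; rfl
      have hW (j : ℕ) (hj : j < N) : t.cplx N 5 j = ω ^ j := by
        rw [← hr'.table j hj, State.cplx, hag.reals _ (by omega), hag.reals _ (by omega)]; rfl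
      rw [p4, hA' _ (by omega), hA' _ hlt, hW _ (by omega), ← stridedDFT_halve hpos hdvd hω]
    · rintro t ⟨p1, p2, p3⟩
      refine ⟨hf'.trans p1, ?_, p3⟩
      rw [p2, State.storeNat_nats, Function.update_self]
  · rintro s' ⟨hf, _, hA⟩
    refine ⟨hf, fun i hi => ?_⟩
    rw [hA i hi, Nat.sub_self, pow_zero, stridedDFT_one]

/-- One squaring of the roots of the polynomial in the array `0`. -/
def Prog.squareRoots : Prog :=
  .seq (.mapArray (.seq (.copy (.arr 3 (.cell 4)) (.cell 4))
    (.setReal (.arr 4 (.cell 4)) (.lit 0)))) <|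
  .seq .fft <|
  .seq (.mapArray (.cmul (.arr 3 (.cell 4)) (.arr 4 (.cell 4)) (.arr 1 (.cell 4)) (.arr 2 (.cell 4))
    (.arr 1 (.mod (.add (.cell 4) (.div (.cell 1) (.lit 2))) (.cell 1)))
    (.arr 2 (.mod (.add (.cell 4) (.div (.cell 1) (.lit 2))) (.cell 1))) (.arr 7 (.lit 0)))) <|
  .seq .fft <|
  .seq (.forUpTo (.add (.cell 0) (.lit 1)) (.copy (.cell 4)
    (.arr 1 (.mod (.sub (.cell 1) (.mul (.lit 2) (.cell 4))) (.cell 1))))) <|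
  .setNat (.lit 3) (.mul (.lit 2) (.cell 3))

theorem Prog.meets_mapArray_load {s : State} {N : ℕ} (hN : s.nats 1 = N) :
    (Prog.mapArray (.seq (.copy (.arr 3 (.cell 4)) (.cell 4))
      (.setReal (.arr 4 (.cell 4)) (.lit 0)))).Meets s (4 + N * 8) fun s' =>
      Frame N s s' ∧ ∀ i < N, s'.cplx N 1 i = (s.reals i : ℂ) := by
  refine (Prog.meets_mapArray (C := 2) (F := fun i => (s.reals i : ℂ)) hN ?_).mono (by omega)
    fun _ h => ⟨h.1, h.2.2⟩
  intro i hi t h4 hag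
  have ht1 : t.nats 1 = N := by rw [hag.nats 1 (by omega), hN]
  refine ⟨by simp [Prog.cost], ?_⟩
  simp only [Prog.run, NatExpr.eval, State.storeReal_nats, State.storeReal_reals, h4, ht1]
  refine ⟨trivial, fun _ _ => trivial, fun x h1 h2 h3 => ?_, ?_⟩
  · simp (disch := omega) only [Function.update_of_ne]
  · simp (disch := omega) only [State.cplx, State.storeReal_reals, Function.update_of_ne,
      Function.update_self, Nat.reduceAdd]
    rw [hag.reals i (by omega)]
    apply Complex.ext <;> simp

theorem Prog.meets_mapArray_mul {s : State} {N : ℕ} (hN : s.nats 1 = N) :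
    (Prog.mapArray (.cmul (.arr 3 (.cell 4)) (.arr 4 (.cell 4))
    (.arr 1 (.cell 4)) (.arr 2 (.cell 4))
    (.arr 1 (.mod (.add (.cell 4) (.div (.cell 1) (.lit 2))) (.cell 1)))
    (.arr 2 (.mod (.add (.cell 4) (.div (.cell 1) (.lit 2))) (.cell 1)))
    (.arr 7 (.lit 0)))).Meets s (4 + N * 12) fun s' =>
      Frame N s s' ∧ ∀ i < N, s'.cplx N 1 i = s.cplx N 1 i * s.cplx N 1 ((i + N / 2) % N) := by
  refine (Prog.meets_mapArray (C := 6)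
    (F := fun i => s.cplx N 1 i * s.cplx N 1 ((i + N / 2) % N)) hN ?_).mono (by omega)
    fun _ h => ⟨h.1, h.2.2⟩
  intro i hi t h4 hag
  have ht1 : t.nats 1 = N := by rw [hag.nats 1 (by omega), hN]
  have hlt : (i + N / 2) % N < N := Nat.mod_lt _ (by omega)
  refine ⟨by simp [Prog.cost_cmul], ?_⟩
  rw [Prog.run_cmul]
  · simp only [NatExpr.eval, State.storeReal_nats, State.storeReal_reals, h4, ht1]
    refine ⟨trivial, fun _ _ => trivial, fun x h1 h2 h3 => ?_, ?_⟩
    · simp (disch := omega) only [Function.update_of_ne]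
    · simp (disch := omega) only [State.cplx, State.storeReal_reals, Function.update_of_ne,
        Function.update_self, Nat.reduceAdd]
      simp (disch := omega) only [hag.reals]
      apply Complex.ext
      · simp only [Complex.mul_re]
      · simp only [Complex.mul_im]
  · simp only [NatExpr.eval, h4, ht1]; omega
  all_goals
    simp only [List.mem_cons, List.not_mem_nil, or_false, forall_eq_or_imp, forall_eq,
      NatExpr.eval, h4, ht1]
    omega

theorem Prog.meets_forUpTo_extract {s : State} {n N : ℕ} (hn : s.nats 0 = n) (hN : s.nats 1 = N)
    (hnN : n < N) :
    (Prog.forUpTo (.add (.cell 0) (.lit 1)) (.copy (.cell 4)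
      (.arr 1 (.mod (.sub (.cell 1) (.mul (.lit 2) (.cell 4))) (.cell 1))))).Meets s
      (2 + (n + 1) * 3)
      fun s' => (∀ k < 4, s'.nats k = s.nats k) ∧ (∀ x, n < x → s'.reals x = s.reals x) ∧
        ∀ i ≤ n, s'.reals i = (s.cplx N 1 ((N - 2 * i) % N)).re := by
  refine (Prog.Meets.forUpTo (m := n + 1) (C := 1) (fun m s' => (∀ k < 4, s'.nats k = s.nats k) ∧
    (∀ x, n < x → s'.reals x = s.reals x) ∧
    ∀ i < m, s'.reals i = (s.cplx N 1 ((N - 2 * i) % N)).re) ?_ ?_ ?_).mono (by omega) ?_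
  · simp [NatExpr.eval, State.storeNat_nats, hn]
  · refine ⟨fun k hk => ?_, fun x _ => rfl, fun i hi => absurd hi (by omega)⟩
    rw [State.storeNat_nats, Function.update_of_ne (by omega)]
  · rintro i hi t h4 ⟨p1, p2, p3⟩
    have ht1 : t.nats 1 = N := by rw [p1 1 (by omega), hN]
    refine ⟨le_rfl, ?_⟩
    simp only [Prog.run, NatExpr.eval, State.storeReal_nats, State.storeReal_reals,
      State.storeNat_reals, State.storeNat_nats, h4, ht1]
    refine ⟨trivial, fun k hk => ?_, fun x hx => ?_, fun j hj => ?_⟩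
    · rw [Function.update_of_ne (by omega), p1 k hk]
    · rw [Function.update_of_ne (by omega), p2 x hx]
    · rcases Nat.lt_succ_iff_lt_or_eq.1 hj with hj | rfl
      · rw [Function.update_of_ne (by omega), p3 j hj]
      · rw [Function.update_self, p2 _ (by omega)]; rfl
  · rintro s' ⟨p1, p2, p3⟩
    exact ⟨p1, p2, fun i hi => p3 i (by omega)⟩

/-- The state while the roots are being squared: cell `0` holds the degree of `q`, the array `0`
its coefficients. -/
structure Holds (n L : ℕ) (ω : ℂ) (q : Polynomial ℝ) (s : State) : Prop where
  ready : FFTReady L ω s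
  deg : s.nats 0 = n
  coeff : ∀ i < 2 ^ L, s.reals i = q.coeff i

open Polynomial in
theorem Prog.meets_squareRoots {s : State} {n l : ℕ} {ω : ℂ} {q : ℝ[X]}
    (hs : Holds n (l + 1) ω q s) (hω : ω ^ 2 ^ l = -1) (hq : q ≠ 0) (hdeg : q.natDegree = n)
    (hn : 2 * n < 2 ^ (l + 1)) :
    Prog.squareRoots.Meets s (60 * 2 ^ (l + 1) * (l + 2)) fun s' =>
      Holds n (l + 1) ω (graeffe (2 ^ (l + 1) : ℕ) q) s' ∧ s'.nats 3 = 2 * s.nats 3 := by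
  set L := l + 1 with hL
  set N := 2 ^ L with hN
  have hωN : ω ^ N = 1 := by rw [hN, hL, pow_succ, pow_mul, hω]; norm_num
  have hN2 : N / 2 = 2 ^ l := by
    rw [hN, hL, pow_succ, Nat.mul_div_cancel _ (by norm_num)]
  have hNpos : 0 < N := by positivity
  have hcost : 4 + N * 8 + (2 + L * (6 + 17 * N) + (4 + N * 12 + (2 + L * (6 + 17 * N) +
      (2 + (n + 1) * 3 + 1)))) ≤ 60 * N * (l + 2) := by
    have h1 : n + 1 ≤ N := by omega
    have h2 : 1 ≤ N := hNpos
    have h3 : 1 ≤ L := by omega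
    have h4 : L ≤ L * N := Nat.le_mul_of_pos_right _ hNpos
    have h5 : N ≤ L * N := Nat.le_mul_of_pos_left _ (by omega)
    have : 60 * N * (l + 2) = 60 * (L * N) + 60 * N := by rw [hL]; ring
    rw [this]
    have : L * (6 + 17 * N) = 6 * L + 17 * (L * N) := by ring
    rw [this]
    omega
  refine Prog.Meets.mono ?_ hcost fun _ h => h
  refine (Prog.meets_mapArray_load hs.ready.length).seq ?_
  rintro s1 ⟨f1, a1⟩
  refine (Prog.meets_fft (hs.ready.of_frame f1) hωN).seq ?_
  rintro s2 ⟨f2, a2⟩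
  have f2 := f1.trans f2
  refine (Prog.meets_mapArray_mul (hs.ready.of_frame f2).length).seq ?_
  rintro s3 ⟨f3, a3⟩
  have f3 := f2.trans f3
  refine (Prog.meets_fft (hs.ready.of_frame f3) hωN).seq ?_
  rintro s4 ⟨f4, a4⟩
  have f4 := f3.trans f4
  have r4 := hs.ready.of_frame f4
  refine (Prog.meets_forUpTo_extract (n := n) (by rw [f4.nats 0 (by omega), hs.deg]) r4.length
    (by omega)).seq ?_
  rintro s5 ⟨p1, p2, p3⟩
  refine ⟨le_rfl, ?_⟩
  have e3 : s5.nats 3 = s.nats 3 := by rw [p1 3 (by omega), f4.nats 3 (by omega)]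
  simp only [Prog.run, NatExpr.eval, e3]
  refine ⟨⟨⟨?_, ?_, ?_⟩, ?_, ?_⟩, ?_⟩
  · rw [State.storeNat_nats, Function.update_of_ne (by omega), p1 1 (by omega), r4.length]
  · rw [State.storeNat_nats, Function.update_of_ne (by omega), p1 2 (by omega), r4.log]
  · intro i hi
    rw [← r4.table i hi]
    simp only [State.cplx, State.storeNat_reals]
    rw [p2 _ (by omega), p2 _ (by omega)]
  · rw [State.storeNat_nats, Function.update_of_ne (by omega), p1 0 (by omega),
      f4.nats 0 (by omega), hs.deg]
  · intro i hi
    rw [State.storeNat_reals]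
    rcases Nat.lt_or_ge n i with hni | hni
    -- Beyond the degree nothing is written: the zero padding of the old polynomial serves the new
    -- one, which has the same degree.
    · rw [p2 i hni, f4.reals i (by omega), hs.coeff i hi,
        coeff_eq_zero_of_natDegree_lt (by omega), coeff_eq_zero_of_natDegree_lt]
      rw [natDegree_graeffe (by positivity) hq]; omega
    · rw [p3 i hni, a4 _ (Nat.mod_lt _ hNpos), coeff_graeffe]
      set f := q.map (algebraMap ℝ ℂ) with hf
      have hfd : f.natDegree = n := by rw [hf, natDegree_map, hdeg]
      have b1 (x : ℕ) (hx : x < N) : s2.cplx N 1 x = dft N ω f.coeff x := by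
        rw [a2 x hx]
        refine dft_congr (fun i hi => ?_) _
        rw [a1 i hi, hs.coeff i hi, hf, coeff_map]; rfl
      have b2 : dft N ω (s3.cplx N 1) ((N - 2 * i) % N) =
          (N : ℂ) * (f * f.comp (-X)).coeff (2 * i) := by
        rw [← dft_mul_dft_half hω (by rw [hfd]; exact hn) (show 2 * i < N by omega)]
        refine dft_congr (fun x hx => ?_) _
        rw [a3 x hx, b1 x hx, b1 _ (Nat.mod_lt _ hNpos), hN2]
      have b3 : f * f.comp (-X) = (q * q.comp (-X)).map (algebraMap ℝ ℂ) := by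
        rw [Polynomial.map_mul, map_comp]; simp [hf]
      rw [b2, b3, coeff_map]
      simp
  · rw [State.storeNat_nats, Function.update_self]

end RealRAM

/-! ### Transform length, root of unity, and the iterated squaring -/

namespace RealRAM

/-- Store in cells `1` and `2` a power of two `N > 2 * n` and its logarithm. -/
def Prog.chooseLength : Prog :=
  .seq (.setNat (.lit 1) (.lit 2)) <| .seq (.setNat (.lit 2) (.lit 1)) <|
  .loop (.cell 0) <| .ifNat (.cell 1) (.mul (.lit 2) (.cell 0))
    (.seq (.setNat (.lit 1) (.mul (.lit 2) (.cell 1)))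
      (.setNat (.lit 2) (.add (.cell 2) (.lit 1)))) .skip

theorem Prog.meets_chooseLength {s : State} {n : ℕ} (hn : s.nats 0 = n) (hpos : 1 ≤ n) :
    Prog.chooseLength.Meets s (3 + n * 4) fun s' => s'.nats 0 = n ∧ s'.reals = s.reals ∧
      ∃ l, s'.nats 1 = 2 ^ (l + 1) ∧ s'.nats 2 = l + 1 ∧ 2 * n < 2 ^ (l + 1) ∧
        2 ^ (l + 1) ≤ 4 * n := by
  have h1 : (Prog.setNat (.lit 1) (.lit 2)).Meets s 1 fun s' => s' = s.storeNat 1 2 := ⟨le_rfl, rfl⟩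
  have h2 : (Prog.setNat (.lit 2) (.lit 1)).Meets (s.storeNat 1 2) 1
    fun s' => s' = (s.storeNat 1 2).storeNat 2 1 := ⟨le_rfl, rfl⟩
  refine (h1.seq (C' := 1 + (1 + n * (1 + 3))) ?_).mono (by omega) fun _ h => h
  rintro _ rfl
  refine h2.seq ?_
  rintro _ rfl
  -- Either the length is already large enough or every pass so far has doubled it; `n` doublings of
  -- `2` always exceed `2 * n`. The bound by `4 * n` persists because doubling happens only at
  -- lengths up to `2 * n`.
  refine (Prog.Meets.loop (m := n) (fun i s' => s'.nats 0 = n ∧ s'.reals = s.reals ∧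
      ∃ l, s'.nats 1 = 2 ^ (l + 1) ∧ s'.nats 2 = l + 1 ∧ (2 * n < 2 ^ (l + 1) ∨ l = i) ∧
        2 ^ (l + 1) ≤ 4 * n) ?_ ?_ ?_).mono le_rfl ?_
  · simp [NatExpr.eval, State.storeNat_nats, hn]
  · refine ⟨by simp [State.storeNat_nats, hn], rfl, 0, by simp [State.storeNat_nats],
      by simp [State.storeNat_nats], Or.inr rfl, by simp; omega⟩
  · rintro i hi s' ⟨p0, pr, l, p1, p2, p3, p4⟩
    refine ⟨?_, ?_⟩
    · simp only [Prog.cost, NatExpr.eval]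
      by_cases h : s'.nats 1 ≤ 2 * s'.nats 0 <;> simp [h]
    · simp only [Prog.run, NatExpr.eval, p0, p1]
      split_ifs with hle
      · simp (disch := omega) only [State.storeNat_nats, State.storeNat_reals,
          Function.update_of_ne, Function.update_self, p0, p2]
        refine ⟨trivial, pr, l + 1, by ring, rfl, Or.inr (by omega), ?_⟩
        rw [pow_succ]; omega
      · exact ⟨p0, pr, l, p1, p2, Or.inl (by omega), p4⟩
  · rintro s' ⟨p0, pr, l, p1, p2, p3, p4⟩
    refine ⟨p0, pr, l, p1, p2, ?_, p4⟩
    rcases p3 with h | rfl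
    · exact h
    · have := Nat.lt_two_pow_self (n := l)
      rw [pow_succ]; omega

theorem rootOp_two {x : ℝ} (hx : 0 ≤ x) : rootOp 2 x = √x := by
  rw [rootOp, if_pos ⟨by norm_num, hx⟩, Real.sqrt_eq_rpow]; norm_num

/-- These are the half-angle formulas for cosine and sine. On the upper half circle the half angle
lies in the first quadrant, so both nonnegative square roots have the right sign. -/
theorem half_angle {u v : ℝ} (h : u ^ 2 + v ^ 2 = 1) (hv : 0 ≤ v) :
    (⟨√((1 + u) / 2), √((1 - u) / 2)⟩ : ℂ) ^ 2 = ⟨u, v⟩ := by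
  have h1 : 0 ≤ (1 + u) / 2 := by nlinarith [sq_nonneg v, sq_nonneg (u - 1)]
  have h2 : 0 ≤ (1 - u) / 2 := by nlinarith [sq_nonneg v, sq_nonneg (u + 1)]
  have h3 : √((1 + u) / 2) * √((1 - u) / 2) = v / 2 := by
    rw [← Real.sqrt_mul h1, show (1 + u) / 2 * ((1 - u) / 2) = (v / 2) ^ 2 by nlinarith,
      Real.sqrt_sq (by linarith)]
  rw [pow_two]
  apply Complex.ext
  · rw [Complex.mul_re, Real.mul_self_sqrt h1, Real.mul_self_sqrt h2]; dsimp; ring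
  · rw [Complex.mul_im]; dsimp; rw [mul_comm √((1 - u) / 2), h3]; ring

/-- Store `-1`, the complex number to start from, and the constants `1` and `2` in the array `7`. -/
def Prog.startAngle : Prog :=
  .seq (.setReal (.arr 7 (.lit 0)) (.lit 0)) <| .seq (.setReal (.arr 7 (.lit 1)) (.lit 0)) <|
  .seq (.setReal (.arr 7 (.lit 2)) (.lit 1)) <| .seq (.setReal (.arr 7 (.lit 3)) (.lit 2)) <|
  .arith .sub (.arr 7 (.lit 0)) (.arr 7 (.lit 0)) (.arr 7 (.lit 2))

/-- Replace the complex number in the cells `0` and `1` of the array `7` by its square root. -/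
def Prog.halveAngle : Prog :=
  .seq (.arith .sub (.arr 7 (.lit 1)) (.arr 7 (.lit 2)) (.arr 7 (.lit 0))) <|
  .seq (.arith .div (.arr 7 (.lit 1)) (.arr 7 (.lit 1)) (.arr 7 (.lit 3))) <|
  .seq (.root (.arr 7 (.lit 1)) (.lit 2) (.arr 7 (.lit 1))) <|
  .seq (.arith .add (.arr 7 (.lit 0)) (.arr 7 (.lit 2)) (.arr 7 (.lit 0))) <|
  .seq (.arith .div (.arr 7 (.lit 0)) (.arr 7 (.lit 0)) (.arr 7 (.lit 3))) <|
  .root (.arr 7 (.lit 0)) (.lit 2) (.arr 7 (.lit 0))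

/-- Store in the cells `0` and `1` of the array `7` a primitive root of unity. -/
def Prog.unityRoot : Prog :=
  .seq .startAngle (.loop (.sub (.cell 2) (.lit 1)) .halveAngle)

/-- The array `7` starts with a complex number `z` with `z ^ 2 ^ m = -1`, followed by `1`, `2`. -/
structure AngleReady (N m : ℕ) (s s' : State) : Prop where
  nats : s'.nats = s.nats
  reals : ∀ x < 7 * N, s'.reals x = s.reals x
  one : s'.reals (7 * N + 2) = 1
  two : s'.reals (7 * N + 3) = 2
  unit : s'.reals (7 * N) ^ 2 + s'.reals (7 * N + 1) ^ 2 = 1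
  nonneg : 0 ≤ s'.reals (7 * N + 1)
  pow : (⟨s'.reals (7 * N), s'.reals (7 * N + 1)⟩ : ℂ) ^ 2 ^ m = -1

theorem Prog.meets_startAngle {s : State} {N : ℕ} (hN : s.nats 1 = N) :
    Prog.startAngle.Meets s 5 (AngleReady N 0 s) := by
  refine ⟨by simp [Prog.startAngle, Prog.cost], ?_⟩
  have hrun : Prog.startAngle.run s = ((((s.storeReal (7 * N) 0).storeReal (7 * N + 1) 0).storeReal
      (7 * N + 2) 1).storeReal (7 * N + 3) 2).storeReal (7 * N) (-1) := by
    simp (disch := omega) only [Prog.startAngle, Prog.run, NatExpr.eval, State.storeReal_nats, hN,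
      State.storeReal_reals, Function.update_self, Function.update_of_ne, ArithOp.eval,
      Nat.cast_zero, Nat.cast_one, Nat.cast_ofNat, add_zero, zero_sub]
  rw [hrun]
  constructor
  case nats => rfl
  case pow =>
    simp (disch := omega) only [State.storeReal_reals, Function.update_self, Function.update_of_ne,
      pow_zero, pow_one]
    apply Complex.ext <;> simp
  all_goals
    intros
    simp (disch := omega) [State.storeReal_reals, Function.update_self, Function.update_of_ne]

theorem Prog.meets_halveAngle {s s' : State} {N m : ℕ} (hN : s.nats 1 = N)
    (h : AngleReady N m s s') : Prog.halveAngle.Meets s' 6 (AngleReady N (m + 1) s) := by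
  refine ⟨by simp [Prog.halveAngle, Prog.cost], ?_⟩
  have hN' : s'.nats 1 = N := by rw [h.nats, hN]
  set u := s'.reals (7 * N) with hu
  set v := s'.reals (7 * N + 1) with hv
  have h1 : 0 ≤ (1 + u) / 2 := by nlinarith [sq_nonneg v, sq_nonneg (u - 1), h.unit]
  have h2 : 0 ≤ (1 - u) / 2 := by nlinarith [sq_nonneg v, sq_nonneg (u + 1), h.unit]
  have hr (x : ℕ) : (Prog.halveAngle.run s').reals x =
      if x = 7 * N then √((1 + u) / 2) else if x = 7 * N + 1 then √((1 - u) / 2)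
      else s'.reals x := by
    simp (disch := omega) only [Prog.halveAngle, Prog.run, NatExpr.eval, State.storeReal_nats, hN',
      State.storeReal_reals, Function.update_self, Function.update_of_ne, ArithOp.eval, add_zero,
      h.one, h.two, ← hu, rootOp_two h1, rootOp_two h2]
    simp only [Function.update_apply]
    split_ifs <;> rfl
  constructor
  case nats => rw [← h.nats]; rfl
  case reals => intro x hx; rw [hr, if_neg (by omega), if_neg (by omega), h.reals x hx]
  case one => rw [hr, if_neg (by omega), if_neg (by omega), h.one]
  case two => rw [hr, if_neg (by omega), if_neg (by omega), h.two]
  case unit =>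
    rw [hr, hr, if_pos rfl, if_neg (by omega), if_pos rfl, Real.sq_sqrt h1, Real.sq_sqrt h2]
    ring
  case nonneg => rw [hr, if_neg (by omega), if_pos rfl]; positivity
  case pow =>
    rw [hr, hr, if_pos rfl, if_neg (by omega), if_pos rfl, pow_succ', pow_mul,
      half_angle h.unit h.nonneg, h.pow]

theorem Prog.meets_unityRoot {s : State} {N l : ℕ} (hN : s.nats 1 = N) (hL : s.nats 2 = l + 1) :
    Prog.unityRoot.Meets s (6 + l * 7) (AngleReady N l s) := by
  refine ((Prog.meets_startAngle hN).seq (C' := 1 + l * (1 + 6)) ?_).mono (by omega) fun _ h => h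
  intro s1 h1
  refine Prog.Meets.loop (AngleReady N · s) ?_ h1 ?_
  · simp [NatExpr.eval, h1.nats, hL]
  · intro i _ s' h
    exact Prog.meets_halveAngle hN h

/-- Store in the complex array `5` the powers of the number at the start of the array `7`. -/
def Prog.powerTable : Prog :=
  .seq (.setReal (.arr 5 (.lit 0)) (.lit 1)) <| .seq (.setReal (.arr 6 (.lit 0)) (.lit 0)) <|
  .forUpTo (.sub (.cell 1) (.lit 1)) <|
    .cmul (.arr 5 (.add (.cell 4) (.lit 1))) (.arr 6 (.add (.cell 4) (.lit 1)))
      (.arr 5 (.cell 4)) (.arr 6 (.cell 4)) (.arr 7 (.lit 0)) (.arr 7 (.lit 1)) (.arr 7 (.lit 2))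

theorem Prog.meets_powerTable {s : State} {N : ℕ} (hN : s.nats 1 = N) (hpos : 0 < N) :
    Prog.powerTable.Meets s (4 + N * 8) fun s' => (∀ k < 4, s'.nats k = s.nats k) ∧
      (∀ x < 5 * N, s'.reals x = s.reals x) ∧
      ∀ i < N, s'.cplx N 5 i = (⟨s.reals (7 * N), s.reals (7 * N + 1)⟩ : ℂ) ^ i := by
  set ω : ℂ := ⟨s.reals (7 * N), s.reals (7 * N + 1)⟩ with hω
  have h1 : (Prog.setReal (.arr 5 (.lit 0)) (.lit 1)).Meets s 1
      fun s' => s' = s.storeReal (5 * N) 1 := by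
    refine ⟨le_rfl, ?_⟩
    simp [Prog.run, NatExpr.eval, hN]
  have h2 : (Prog.setReal (.arr 6 (.lit 0)) (.lit 0)).Meets (s.storeReal (5 * N) 1) 1
      fun s' => s' = (s.storeReal (5 * N) 1).storeReal (6 * N) 0 := by
    refine ⟨le_rfl, ?_⟩
    simp [Prog.run, NatExpr.eval, hN, State.storeReal_nats]
  refine (h1.seq (C' := 1 + (2 + (N - 1) * (2 + 6))) ?_).mono (by omega) fun _ h => h
  rintro _ rfl
  refine h2.seq ?_
  rintro _ rfl
  refine (Prog.Meets.forUpTo (m := N - 1) (C := 6) (fun m s' => (∀ k < 4, s'.nats k = s.nats k) ∧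
    (∀ x, x < 5 * N ∨ x = 7 * N ∨ x = 7 * N + 1 → s'.reals x = s.reals x) ∧
    ∀ i < m + 1, s'.cplx N 5 i = ω ^ i) ?_ ?_ ?_).mono le_rfl ?_
  · simp [NatExpr.eval, State.storeNat_nats, State.storeReal_nats, hN]
  · refine ⟨fun k hk => ?_, fun x hx => ?_, fun i hi => ?_⟩
    · simp (disch := omega) only [State.storeNat_nats, State.storeReal_nats, Function.update_of_ne]
    · simp (disch := omega) only [State.storeNat_reals, State.storeReal_reals,
        Function.update_of_ne]
    · obtain rfl : i = 0 := by omega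
      simp (disch := omega) only [State.cplx, State.storeNat_reals, State.storeReal_reals,
        Function.update_of_ne, Function.update_self, add_zero, Nat.reduceAdd]
      apply Complex.ext <;> simp
  · rintro i hi t h4 ⟨p1, p2, p3⟩
    have ht1 : t.nats 1 = N := by rw [p1 1 (by omega), hN]
    refine ⟨by rw [Prog.cost_cmul], ?_⟩
    have e1 := p2 (7 * N) (by omega)
    have e2 := p2 (7 * N + 1) (by omega)
    rw [Prog.run_cmul]
    · simp only [NatExpr.eval, State.storeReal_nats, State.storeReal_reals, h4, ht1,
        State.storeNat_nats, State.storeNat_reals, add_zero, e1, e2]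
      refine ⟨trivial, fun k hk => ?_, fun x hx => ?_, fun j hj => ?_⟩
      · rw [Function.update_of_ne (by omega), p1 k hk]
      · simp (disch := omega) only [Function.update_of_ne]
        exact p2 x hx
      · rcases Nat.lt_succ_iff_lt_or_eq.1 hj with hj | rfl
        · rw [← p3 j hj]
          simp (disch := omega) only [State.cplx, State.storeNat_reals, State.storeReal_reals,
            Function.update_of_ne]
        · rw [pow_succ, ← p3 i (by omega)]
          simp (disch := omega) only [State.cplx, State.storeNat_reals, State.storeReal_reals,
            Function.update_of_ne, Function.update_self, Nat.reduceAdd]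
          apply Complex.ext
          · simp only [Complex.mul_re, hω]
          · simp only [Complex.mul_im, hω]
    · simp only [NatExpr.eval, h4, ht1]; omega
    all_goals
      simp only [List.mem_cons, List.not_mem_nil, or_false, forall_eq_or_imp, forall_eq,
        NatExpr.eval, h4, ht1]
      omega
  · rintro s' ⟨p1, p2, p3⟩
    exact ⟨p1, fun x hx => p2 x (Or.inl hx), fun i hi => p3 i (by omega)⟩

/-- Replace the polynomial in the array `0` by one whose roots are the `M`-th powers of its roots,
where `M = 2 ^ (κ + (D + 1) * L)` is stored in cell `3`. -/
def Prog.powerRoots (κ D : ℕ) : Prog :=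
  .seq .chooseLength <| .seq .unityRoot <| .seq .powerTable <| .seq (.setNat (.lit 3) (.lit 1)) <|
  .loop (.add (.lit κ) (.mul (.lit (D + 1)) (.cell 2))) .squareRoots

/-- The outcome of `powerRoots`. -/
structure PoweredRoots (κ D : ℕ) (p : Polynomial ℝ) (s : State) (l : ℕ) (q : Polynomial ℝ) :
    Prop where
  lt_pow : 2 * p.natDegree < 2 ^ (l + 1)
  pow_le : 2 ^ (l + 1) ≤ 4 * p.natDegree
  ne_zero : q ≠ 0
  natDegree_eq : q.natDegree = p.natDegree
  roots_eq : (q.map (algebraMap ℝ ℂ)).roots =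
    (p.map (algebraMap ℝ ℂ)).roots.map (· ^ 2 ^ (κ + (D + 1) * (l + 1)))
  cell_zero : s.nats 0 = p.natDegree
  cell_one : s.nats 1 = 2 ^ (l + 1)
  cell_three : s.nats 3 = 2 ^ (κ + (D + 1) * (l + 1))
  coeff : ∀ i < 2 ^ (l + 1), s.reals i = q.coeff i

/-- The squarings dominate the cost: there are at most `(κ + D + 1) * (l + 2)` of them, each with
`O(2 ^ (l + 1) * (l + 2))` instructions, while the preparation is linear in the transform length. -/
theorem Prog.cost_powerRoots_and_run (κ D : ℕ) {p : Polynomial ℝ} (hp : 1 ≤ p.natDegree) :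
    ∃ l q, PoweredRoots κ D p ((Prog.powerRoots κ D).run (inputState p)) l q ∧
      (Prog.powerRoots κ D).cost (inputState p) ≤
        100 * (κ + D + 1) * 2 ^ (l + 1) * (l + 2) ^ 2 := by
  set n := p.natDegree with hn
  have h0 : (inputState p).nats 0 = n := rfl
  obtain ⟨c1, p0, pr, l, p1, p2, hlt, hle⟩ := Prog.meets_chooseLength h0 hp
  set s1 := Prog.chooseLength.run (inputState p) with hs1
  set N := 2 ^ (l + 1) with hN
  obtain ⟨c2, a2⟩ := Prog.meets_unityRoot p1 p2
  set s2 := Prog.unityRoot.run s1 with hs2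
  have hNpos : 0 < N := by positivity
  have e1 : s2.nats 1 = N := by rw [a2.nats, p1]
  obtain ⟨c3, b1, b2, b3⟩ := Prog.meets_powerTable e1 hNpos
  set s3 := Prog.powerTable.run s2 with hs3
  set ω : ℂ := ⟨s2.reals (7 * N), s2.reals (7 * N + 1)⟩ with hω
  have hp0 : p ≠ 0 := by rintro rfl; simp [hn] at hp
  have start : Holds n (l + 1) ω p (s3.storeNat 3 1) := by
    refine ⟨⟨?_, ?_, b3⟩, ?_, ?_⟩
    · rw [State.storeNat_nats, Function.update_of_ne (by omega), b1 1 (by omega), e1]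
    · rw [State.storeNat_nats, Function.update_of_ne (by omega), b1 2 (by omega), a2.nats, p2]
    · rw [State.storeNat_nats, Function.update_of_ne (by omega), b1 0 (by omega), a2.nats, p0]
    · intro i hi
      rw [State.storeNat_reals, b2 i (by omega), a2.reals i (by omega), pr]
      rfl
  set k := κ + (D + 1) * (l + 1) with hk
  have hloop : (Prog.loop (.add (.lit κ) (.mul (.lit (D + 1)) (.cell 2))) .squareRoots).Meets
      (s3.storeNat 3 1) (1 + k * (1 + 60 * N * (l + 2))) fun s' =>
      ∃ q : Polynomial ℝ, Holds n (l + 1) ω q s' ∧ s'.nats 3 = 2 ^ k ∧ q ≠ 0 ∧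
        q.natDegree = n ∧ (q.map (algebraMap ℝ ℂ)).roots =
          (p.map (algebraMap ℝ ℂ)).roots.map (· ^ 2 ^ k) := by
    refine Prog.Meets.loop (fun m s' =>
      ∃ q : Polynomial ℝ, Holds n (l + 1) ω q s' ∧ s'.nats 3 = 2 ^ m ∧ q ≠ 0 ∧
        q.natDegree = n ∧ (q.map (algebraMap ℝ ℂ)).roots =
          (p.map (algebraMap ℝ ℂ)).roots.map (· ^ 2 ^ m)) ?_ ?_ ?_
    · simp only [NatExpr.eval, start.ready.log, hk]
    · exact ⟨p, start, by rw [State.storeNat_nats, Function.update_self]; rfl, hp0, rfl, by simp⟩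
    · rintro i _ s' ⟨q, hq, h3, hq0, hqd, hqr⟩
      refine (Prog.meets_squareRoots hq a2.pow hq0 hqd hlt).mono le_rfl ?_
      rintro s'' ⟨hq', h3'⟩
      -- This is the constant left over from the two unnormalised transforms.
      have hK : ((2 ^ (l + 1) : ℕ) : ℝ) ≠ 0 := by positivity
      have hd := natDegree_graeffe hK hq0
      refine ⟨_, hq', by rw [h3', h3, pow_succ'], ?_, hd.trans hqd, ?_⟩
      · intro h
        rw [h, hqd, Polynomial.natDegree_zero] at hd
        omega
      · rw [roots_graeffe hK hq0, hqr, Multiset.map_map]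
        refine Multiset.map_congr rfl fun x _ => ?_
        rw [Function.comp_apply, ← pow_mul, ← pow_succ]
  obtain ⟨c4, q, hq, h3, hq0, hqd, hqr⟩ := hloop
  refine ⟨l, q, ⟨hlt, hle, hq0, hqd, hqr, hq.deg, hq.ready.length, h3, hq.coeff⟩, ?_⟩
  have hcost : (Prog.powerRoots κ D).cost (inputState p) ≤
      (3 + n * 4) + ((6 + l * 7) + ((4 + N * 8) + (1 + (1 + k * (1 + 60 * N * (l + 2)))))) :=
    Nat.add_le_add c1 (Nat.add_le_add c2 (Nat.add_le_add c3 (Nat.add_le_add le_rfl c4)))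
  refine hcost.trans ?_
  have hk' : k ≤ (κ + D + 1) * (l + 2) := by
    rw [hk]; nlinarith [Nat.zero_le (κ * l)]
  set G := κ + D + 1 with hG
  set X := N * (l + 2) with hX
  have hX1 : N ≤ X := Nat.le_mul_of_pos_right _ (by omega)
  have hX2 : l + 2 ≤ X := Nat.le_mul_of_pos_left _ hNpos
  have hY : X ≤ G * (l + 2) * X := Nat.le_mul_of_pos_left _ (by positivity)
  calc _ ≤ 15 + 4 * n + 7 * l + 8 * N + k * (61 * X) := by
        have : k * (1 + 60 * N * (l + 2)) ≤ k * (61 * X) := by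
          refine Nat.mul_le_mul_left _ ?_
          rw [hX, mul_assoc]; omega
        omega
    _ ≤ 39 * X + G * (l + 2) * (61 * X) := by
        have := Nat.mul_le_mul_right (61 * X) hk'
        omega
    _ ≤ 39 * (G * (l + 2) * X) + 61 * (G * (l + 2) * X) := by
        have : G * (l + 2) * (61 * X) = 61 * (G * (l + 2) * X) := by ring
        omega
    _ = _ := by rw [hX]; ring

end RealRAM

/-! ### Crossings of monomials and the Newton polygon -/

/-- The positive number at which the monomials `a u * t ^ u` and `a v * t ^ v` agree. -/
noncomputable def crossing (a : ℕ → ℝ) (u v : ℕ) : ℝ := RealRAM.rootOp (v - u) (a u / a v)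

section Crossing

variable {a : ℕ → ℝ} {u v : ℕ} {t : ℝ}

theorem crossing_pos (hu : 0 < a u) (hv : 0 < a v) (huv : u < v) : 0 < crossing a u v := by
  rw [crossing, RealRAM.rootOp, if_pos ⟨by omega, by positivity⟩]
  positivity

theorem crossing_pow (hu : 0 < a u) (hv : 0 < a v) (huv : u < v) :
    crossing a u v ^ (v - u) = a u / a v := by
  rw [crossing, RealRAM.rootOp, if_pos ⟨by omega, by positivity⟩]
  exact Real.rpow_inv_natCast_pow (by positivity) (by omega)

theorem mul_pow_le_of_le_crossing (hu : 0 < a u) (hv : 0 < a v) (huv : u < v) (ht : 0 < t)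
    (h : t ≤ crossing a u v) : a v * t ^ v ≤ a u * t ^ u := by
  have h1 : t ^ (v - u) ≤ a u / a v := by
    rw [← crossing_pow hu hv huv]; exact pow_le_pow_left₀ ht.le h _
  rw [le_div_iff₀ hv] at h1
  calc a v * t ^ v = t ^ (v - u) * a v * t ^ u := by
        rw [show t ^ v = t ^ (v - u) * t ^ u by rw [← pow_add]; congr 1; omega]; ring
    _ ≤ _ := by gcongr

theorem mul_pow_le_of_crossing_le (hu : 0 < a u) (hv : 0 < a v) (huv : u < v) (ht : 0 < t)
    (h : crossing a u v ≤ t) : a u * t ^ u ≤ a v * t ^ v := by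
  have h1 : a u / a v ≤ t ^ (v - u) := by
    rw [← crossing_pow hu hv huv]; exact pow_le_pow_left₀ (crossing_pos hu hv huv).le h _
  rw [div_le_iff₀ hv] at h1
  calc a u * t ^ u ≤ t ^ (v - u) * a v * t ^ u := by gcongr
    _ = _ := by rw [show t ^ v = t ^ (v - u) * t ^ u by rw [← pow_add]; congr 1; omega]; ring

end Crossing

/-- The stack `st 0, …, st (m - 1)` holds vertices of the Newton polygon of `a 0, …, a (i - 1)`;
among them are all those that remain vertices after the addition of `a i`. -/
structure NewtonStack (a : ℕ → ℝ) (st : ℕ → ℕ) (m i : ℕ) : Prop where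
  lt_next : ∀ l < m, st l < i
  mono : ∀ l, l + 1 < m → st l < st (l + 1)
  pos : ∀ l < m, 0 < a (st l)
  crossing_lt : ∀ l, l + 2 < m →
    crossing a (st l) (st (l + 1)) < crossing a (st (l + 1)) (st (l + 2))
  dominated : ∀ u < i, ∀ t, 0 < t → ∀ B, 0 ≤ B → (∀ l < m, a (st l) * t ^ st l ≤ B) →
    a i * t ^ i ≤ B → a u * t ^ u ≤ B
  zero : ∀ u < i, m = 0 ∨ u < st 0 → a u = 0

namespace NewtonStack

variable {a : ℕ → ℝ} {st st' : ℕ → ℕ} {m i : ℕ}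

theorem empty (a : ℕ → ℝ) (st : ℕ → ℕ) : NewtonStack a st 0 0 := by
  constructor <;> intros <;> omega

theorem skip (h : NewtonStack a st m i) (hi : a i = 0) : NewtonStack a st m (i + 1) := by
  refine ⟨fun l hl => (h.lt_next l hl).trans (by omega), h.mono, h.pos, h.crossing_lt, ?_, ?_⟩
  · intro u hu t ht B hB hst _
    rcases Nat.lt_succ_iff_lt_or_eq.1 hu with hu | rfl
    · exact h.dominated u hu t ht B hB hst (by rw [hi, zero_mul]; exact hB)
    · rw [hi, zero_mul]; exact hB
  · intro u hu hz
    rcases Nat.lt_succ_iff_lt_or_eq.1 hu with hu | rfl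
    · exact h.zero u hu hz
    · exact hi

theorem push (h : NewtonStack a st m i) (hi : 0 < a i) (hst : ∀ l < m, st' l = st l)
    (htop : st' m = i)
    (hlt : 2 ≤ m → crossing a (st (m - 2)) (st (m - 1)) < crossing a (st (m - 1)) i) :
    NewtonStack a st' (m + 1) (i + 1) := by
  refine ⟨fun l hl => ?_, fun l hl => ?_, fun l hl => ?_, fun l hl => ?_, ?_, ?_⟩
  · rcases Nat.lt_succ_iff_lt_or_eq.1 hl with hl | rfl
    · rw [hst l hl]; exact (h.lt_next l hl).trans (by omega)
    · omega
  · rw [hst l (by omega)]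
    rcases Nat.lt_succ_iff_lt_or_eq.1 hl with hl | hl
    · rw [hst _ hl]; exact h.mono l hl
    · rw [hl, htop]; exact h.lt_next l (by omega)
  · rcases Nat.lt_succ_iff_lt_or_eq.1 hl with hl | rfl
    · rw [hst l hl]; exact h.pos l hl
    · rwa [htop]
  · rw [hst l (by omega), hst (l + 1) (by omega)]
    rcases Nat.lt_succ_iff_lt_or_eq.1 hl with hl | hl
    · rw [hst _ hl]; exact h.crossing_lt l hl
    · have := hlt (by omega)
      rw [hl, htop]
      rwa [show m - 2 = l by omega, show m - 1 = l + 1 by omega] at this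
  · intro u hu t ht B hB hB' _
    have htop' := hB' m (by omega)
    rw [htop] at htop'
    rcases Nat.lt_succ_iff_lt_or_eq.1 hu with hu | rfl
    · refine h.dominated u hu t ht B hB (fun l hl => ?_) htop'
      rw [← hst l hl]; exact hB' l (by omega)
    · exact htop'
  · rintro u hu (hz | hz)
    · omega
    · rcases Nat.eq_zero_or_pos m with rfl | hm
      · rw [htop] at hz; exact h.zero u hz (Or.inl rfl)
      · rw [hst 0 hm] at hz
        exact h.zero u (hz.trans (h.lt_next 0 hm)) (Or.inr hz)

/-- The top monomial is never needed: up to its crossing with the one below, that one dominates it,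
and from its crossing with `i` on, the monomial `i` does. The hypothesis says that these two ranges
cover all `t > 0`. -/
theorem pop (h : NewtonStack a st m i) (hi : 0 < a i) (hm : 2 ≤ m)
    (hle : crossing a (st (m - 1)) i ≤ crossing a (st (m - 2)) (st (m - 1))) :
    NewtonStack a st (m - 1) i := by
  refine ⟨fun l hl => h.lt_next l (by omega), fun l hl => h.mono l (by omega),
    fun l hl => h.pos l (by omega), fun l hl => h.crossing_lt l (by omega), ?_, ?_⟩
  · intro u hu t ht B hB hB' hiB
    refine h.dominated u hu t ht B hB (fun l hl => ?_) hiB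
    rcases Nat.lt_or_ge l (m - 1) with hl' | hl'
    · exact hB' l hl'
    obtain rfl : l = m - 1 := by omega
    have h2 : st (m - 2) < st (m - 1) := by
      have := h.mono (m - 2) (by omega)
      rwa [show m - 2 + 1 = m - 1 by omega] at this
    have p1 := h.pos (m - 1) (by omega)
    have p2 := h.pos (m - 2) (by omega)
    rcases le_total t (crossing a (st (m - 2)) (st (m - 1))) with hc | hc
    · exact (mul_pow_le_of_le_crossing p2 p1 h2 ht hc).trans (hB' (m - 2) (by omega))
    · exact (mul_pow_le_of_crossing_le p1 hi (h.lt_next _ (by omega)) ht (hle.trans hc)).trans hiB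
  · intro u hu hz
    exact h.zero u hu (by omega)

theorem crossing_mono (h : NewtonStack a st m i) {l l' : ℕ} (hll : l ≤ l') (hl' : l' + 1 < m) :
    crossing a (st l) (st (l + 1)) ≤ crossing a (st l') (st (l' + 1)) := by
  induction l', hll using Nat.le_induction with
  | base => rfl
  | succ k _ ih => exact (ih (by omega)).trans (h.crossing_lt k hl').le

/-- Crossings increase along the stack, so at the `l`-th crossing the monomials increase from the
bottom up to `l` and do not increase from `l` on. -/
theorem stack_le (h : NewtonStack a st m i) {l : ℕ} (hl : l + 1 < m) (k : ℕ) (hk : k < m) :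
    a (st k) * crossing a (st l) (st (l + 1)) ^ st k ≤
      a (st l) * crossing a (st l) (st (l + 1)) ^ st l := by
  set t := crossing a (st l) (st (l + 1)) with ht
  have ht0 : 0 < t := crossing_pos (h.pos l (by omega)) (h.pos _ hl) (h.mono l hl)
  rcases le_total k l with hkl | hkl
  · have key : ∀ b, k ≤ b → b ≤ l → a (st k) * t ^ st k ≤ a (st b) * t ^ st b := by
      intro b hb
      induction b, hb using Nat.le_induction with
      | base => intro _; rfl
      | succ b _ ihb =>
        intro hbl
        refine (ihb (by omega)).trans ?_
        exact mul_pow_le_of_crossing_le (h.pos b (by omega)) (h.pos _ (by omega))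
          (h.mono b (by omega)) ht0 (h.crossing_mono (by omega) hl)
    exact key l hkl le_rfl
  · induction k, hkl using Nat.le_induction with
    | base => rfl
    | succ b hb ihb =>
      refine le_trans ?_ (ihb (by omega))
      exact mul_pow_le_of_le_crossing (h.pos b (by omega)) (h.pos _ hk) (h.mono b hk) ht0
        (h.crossing_mono hb hk)

end NewtonStack

/-- `ρ` is the radius that the Newton polygon of `a 0, …, a n` assigns to the `j`-th largest root,
counted from `0`. -/
def IsNewtonRadius (a : ℕ → ℝ) (n j : ℕ) (ρ : ℝ) : Prop :=
  (ρ = 0 ∧ ∃ V, n - j ≤ V ∧ ∀ i < V, a i = 0) ∨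
    ∃ U V, U < n - j ∧ n - j ≤ V ∧ 0 < a V ∧ 0 < ρ ∧
      (∀ i, a i * ρ ^ i ≤ a U * ρ ^ U) ∧ ∀ i, a i * ρ ^ i ≤ a V * ρ ^ V

theorem NewtonStack.isNewtonRadius_zero {a : ℕ → ℝ} {st : ℕ → ℕ} {m n j : ℕ}
    (h : NewtonStack a st m (n + 1)) (hm : 1 ≤ m) (hj : n - j ≤ st 0) :
    IsNewtonRadius a n j 0 :=
  Or.inl ⟨rfl, st 0, hj, fun i hi => h.zero i (hi.trans (h.lt_next 0 hm)) (Or.inr hi)⟩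

theorem NewtonStack.isNewtonRadius_crossing {a : ℕ → ℝ} {st : ℕ → ℕ} {m n j l : ℕ}
    (h : NewtonStack a st m (n + 1)) (ha : ∀ i, n < i → a i = 0) (hl : l + 1 < m)
    (hj : st l < n - j) (hj' : n - j ≤ st (l + 1)) :
    IsNewtonRadius a n j (crossing a (st l) (st (l + 1))) := by
  have p0 := h.pos l (by omega)
  have p1 := h.pos _ hl
  have h1 := h.mono l hl
  have ht := crossing_pos p0 p1 h1
  set t := crossing a (st l) (st (l + 1)) with htdef
  have hmax (i : ℕ) : a i * t ^ i ≤ a (st l) * t ^ st l := by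
    have hB : 0 ≤ a (st l) * t ^ st l := by positivity
    have hbig (k : ℕ) (hk : n < k) : a k * t ^ k ≤ a (st l) * t ^ st l := by
      rw [ha k hk, zero_mul]; exact hB
    rcases Nat.lt_or_ge n i with hi | hi
    · exact hbig i hi
    -- The pending monomial is the one of index `n + 1`, which vanishes, so the stack alone controls
    -- everything.
    · exact h.dominated i (by omega) t ht _ hB (fun k hk => h.stack_le hl k hk) (hbig _ (by omega))
  refine Or.inr ⟨st l, st (l + 1), hj, hj', p1, ht, hmax, fun i => (hmax i).trans ?_⟩
  exact mul_pow_le_of_crossing_le p0 p1 h1 ht le_rfl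

theorem TropicallyClose.isNewtonRadius {n : ℕ} {A : ℝ} {f : Fin n → ℝ} {a : ℕ → ℝ}
    (h : TropicallyClose A f a) (ha : ∀ i, 0 ≤ a i) (hf : ∀ j, 0 ≤ f j) {j : Fin n} {ρ : ℝ}
    (hρ : IsNewtonRadius a n j ρ) : 0 ≤ ρ ∧ f j ≤ 4 ^ n * ρ ∧ ρ ≤ 4 ^ n * f j := by
  rcases hρ with ⟨rfl, V, hV, hz⟩ | ⟨U, V, hU, hV, hpos, hρ, h1, h2⟩
  · have := h.le_zero j hV hz ha
    exact ⟨le_rfl, by simpa using this, mul_nonneg (by positivity) (hf j)⟩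
  · exact ⟨hρ.le, h.le_of_vertex j hρ hV hpos h2, h.ge_of_vertex j hρ hU h1⟩

/-! ### The Newton polygon as a program -/

namespace RealRAM

theorem Prog.cost_ifNat_le {a b : NatExpr} {P Q : Prog} {s : State} {C : ℕ} (hP : P.cost s ≤ C)
    (hQ : Q.cost s ≤ C) : (Prog.ifNat a b P Q).cost s ≤ 1 + C := by
  rw [Prog.cost]
  refine Nat.add_le_add_left ?_ 1
  by_cases h : a.eval s ≤ b.eval s
  · rwa [if_pos h]
  · rwa [if_neg h]

theorem Prog.cost_ifReal_le {a b : NatExpr} {P Q : Prog} {s : State} {C : ℕ} (hP : P.cost s ≤ C)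
    (hQ : Q.cost s ≤ C) : (Prog.ifReal a b P Q).cost s ≤ 1 + C := by
  rw [Prog.cost]
  refine Nat.add_le_add_left ?_ 1
  by_cases h : s.reals (a.eval s) ≤ s.reals (b.eval s)
  · rwa [if_pos h]
  · rwa [if_neg h]

/-- Store the absolute values of the entries `0, …, n` of the array `0` in the array `1`, and `0`
in the first cell of the array `7`. -/
def Prog.absArray : Prog :=
  .seq (.setReal (.arr 7 (.lit 0)) (.lit 0)) <| .forUpTo (.add (.cell 0) (.lit 1)) <|
    .ifReal (.cell 4) (.arr 7 (.lit 0)) (.arith .sub (.arr 1 (.cell 4)) (.arr 7 (.lit 0)) (.cell 4))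
      (.copy (.arr 1 (.cell 4)) (.cell 4))

/-- The array `1` holds `a 0, …, a n`, the array `7` starts with `0`, and cells `0`, `1`, `3` hold
`n`, `N`, `M`. -/
structure AbsReady (n N M : ℕ) (a : ℕ → ℝ) (s : State) : Prop where
  deg : s.nats 0 = n
  length : s.nats 1 = N
  exponent : s.nats 3 = M
  entry : ∀ i ≤ n, s.reals (N + i) = a i
  zero : s.reals (7 * N) = 0

theorem AbsReady.storeNat {n N M : ℕ} {a : ℕ → ℝ} {s : State} (h : AbsReady n N M a s) {k : ℕ}
    (hk : 4 ≤ k) (v : ℕ) : AbsReady n N M a (s.storeNat k v) := by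
  refine ⟨?_, ?_, ?_, h.entry, h.zero⟩ <;>
    rw [State.storeNat_nats, Function.update_of_ne (by omega)]
  exacts [h.deg, h.length, h.exponent]

theorem AbsReady.storeReal {n N M : ℕ} {a : ℕ → ℝ} {s : State} (h : AbsReady n N M a s) {x : ℕ}
    (hx : x < N ∨ N + n < x) (hx' : x ≠ 7 * N) (v : ℝ) : AbsReady n N M a (s.storeReal x v) := by
  refine ⟨h.deg, h.length, h.exponent, fun i hi => ?_, ?_⟩ <;>
    rw [State.storeReal_reals, Function.update_of_ne (by omega)]
  exacts [h.entry i hi, h.zero]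

theorem Prog.meets_absArray {s : State} {n N M : ℕ} (hn : s.nats 0 = n) (hN : s.nats 1 = N)
    (hM : s.nats 3 = M) (hnN : n < N) :
    Prog.absArray.Meets s (7 + n * 4) (AbsReady n N M fun i => |s.reals i|) := by
  have h1 : (Prog.setReal (.arr 7 (.lit 0)) (.lit 0)).Meets s 1
      fun s' => s' = s.storeReal (7 * N) 0 := by
    refine ⟨le_rfl, ?_⟩
    simp [Prog.run, NatExpr.eval, hN]
  refine (h1.seq (C' := 2 + (n + 1) * (2 + 2)) ?_).mono (by omega) fun _ h => h
  rintro _ rfl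
  refine (Prog.Meets.forUpTo (m := n + 1) (C := 2) (fun m s' => s'.nats 0 = n ∧ s'.nats 1 = N ∧
    s'.nats 3 = M ∧ s'.reals (7 * N) = 0 ∧ (∀ x < N, s'.reals x = s.reals x) ∧
    ∀ i < m, s'.reals (N + i) = |s.reals i|) ?_ ?_ ?_).mono le_rfl ?_
  · simp [NatExpr.eval, State.storeNat_nats, State.storeReal_nats, hn]
  · refine ⟨?_, ?_, ?_, ?_, fun x hx => ?_, fun i hi => absurd hi (by omega)⟩
    · simpa [State.storeNat_nats, State.storeReal_nats] using hn
    · simpa [State.storeNat_nats, State.storeReal_nats] using hN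
    · simpa [State.storeNat_nats, State.storeReal_nats] using hM
    · simp [State.storeNat_reals, State.storeReal_reals]
    · rw [State.storeNat_reals, State.storeReal_reals, Function.update_of_ne (by omega)]
  · rintro i hi t h4 ⟨p0, p1, p3, pz, pr, pa⟩
    have hrun : (Prog.ifReal (.cell 4) (.arr 7 (.lit 0))
        (.arith .sub (.arr 1 (.cell 4)) (.arr 7 (.lit 0)) (.cell 4))
        (.copy (.arr 1 (.cell 4)) (.cell 4))).run t = t.storeReal (N + i) |s.reals i| := by
      simp only [Prog.run, NatExpr.eval, h4, p1, add_zero, pz, pr i (by omega), ArithOp.eval,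
        zero_sub, one_mul]
      split_ifs with h
      · rw [abs_of_nonpos h]
      · rw [abs_of_pos (not_le.1 h)]
    refine ⟨?_, ?_⟩
    · exact Prog.cost_ifReal_le le_rfl le_rfl
    rw [hrun]
    refine ⟨h4, ?_⟩
    simp (disch := omega) only [State.storeNat_nats, State.storeReal_nats, State.storeNat_reals,
      State.storeReal_reals, Function.update_of_ne]
    refine ⟨p0, p1, p3, pz, fun x hx => ?_, fun j hj => ?_⟩
    · rw [Function.update_of_ne (by omega), pr x hx]
    · rcases Nat.lt_succ_iff_lt_or_eq.1 hj with hj | rfl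
      · rw [Function.update_of_ne (by omega), pa j hj]
      · rw [Function.update_self]
  · rintro s' ⟨p0, p1, p3, pz, _, pa⟩
    exact ⟨p0, p1, p3, fun i hi => pa i (by omega), pz⟩

/-- Push the content of cell `4` on the stack, whose size is in cell `5`. -/
def Prog.push : Prog :=
  .seq (.setNat (.add (.lit 16) (.cell 5)) (.cell 4)) <|
  .seq (.setNat (.lit 5) (.add (.cell 5) (.lit 1))) (.setNat (.lit 4) (.add (.cell 4) (.lit 1)))

/-- Store in cell `k` of the array `7` the crossing of two entries of the array `1`. -/
def Prog.cross (k : ℕ) (u v : NatExpr) : Prog :=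
  .seq (.arith .div (.arr 7 (.lit k)) (.arr 1 u) (.arr 1 v))
    (.root (.arr 7 (.lit k)) (.sub v u) (.arr 7 (.lit k)))

/-- The topmost vertex on the stack. -/
abbrev NatExpr.top : NatExpr := .load (.add (.lit 15) (.cell 5))

/-- The vertex below the topmost one. -/
abbrev NatExpr.second : NatExpr := .load (.add (.lit 14) (.cell 5))

/-- One step in the computation of the Newton polygon. -/
def Prog.newtonStep : Prog :=
  .ifNat (.cell 4) (.cell 0)
    (.ifReal (.arr 1 (.cell 4)) (.arr 7 (.lit 0)) (.setNat (.lit 4) (.add (.cell 4) (.lit 1)))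
      (.ifNat (.cell 5) (.lit 1) .push
        (.seq (.cross 1 .second .top) <| .seq (.cross 2 .top (.cell 4)) <|
          .ifReal (.arr 7 (.lit 2)) (.arr 7 (.lit 1))
            (.setNat (.lit 5) (.sub (.cell 5) (.lit 1))) .push))) .skip

/-- The stack in memory. -/
def State.stack (s : State) (l : ℕ) : ℕ := s.nats (16 + l)

theorem Prog.run_cross {n N M : ℕ} {a : ℕ → ℝ} {s : State} (h : AbsReady n N M a s)
    (k : ℕ) {u v : NatExpr} (hu : u.eval s ≤ n) (hv : v.eval s ≤ n) :
    ∃ w, (Prog.cross k u v).run s =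
      (s.storeReal (7 * N + k) w).storeReal (7 * N + k) (crossing a (u.eval s) (v.eval s)) := by
  refine ⟨a (u.eval s) / a (v.eval s), ?_⟩
  simp only [Prog.cross, Prog.run, NatExpr.eval, State.storeReal_nats, NatExpr.eval_storeReal,
    h.length, State.storeReal_reals, Function.update_self, ArithOp.eval, one_mul, h.entry _ hu,
    h.entry _ hv, crossing]

/-- The state while the Newton polygon is being computed. -/
structure NewtonState (n N M : ℕ) (a : ℕ → ℝ) (i m : ℕ) (s : State) : Prop where
  ready : AbsReady n N M a s
  index : s.nats 4 = i
  size : s.nats 5 = m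
  stack : NewtonStack a s.stack m i
  le : i ≤ n + 1
  last : i = n + 1 → 1 ≤ m ∧ s.stack (m - 1) = n

theorem NewtonState.run_push {n N M i m : ℕ} {a : ℕ → ℝ} {s : State}
    (h : NewtonState n N M a i m s) (hi : 0 < a i) (hin : i ≤ n)
    (hlt : 2 ≤ m → crossing a (s.stack (m - 2)) (s.stack (m - 1)) <
      crossing a (s.stack (m - 1)) i) :
    NewtonState n N M a (i + 1) (m + 1) (Prog.push.run s) := by
  have hrun : Prog.push.run s =
      ((s.storeNat (16 + m) i).storeNat 5 (m + 1)).storeNat 4 (i + 1) := by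
    simp (disch := omega) only [Prog.push, Prog.run, NatExpr.eval, State.storeNat_nats,
      Function.update_of_ne, h.index, h.size]
  rw [hrun]
  have e1 (l : ℕ) : (((s.storeNat (16 + m) i).storeNat 5 (m + 1)).storeNat 4 (i + 1)).stack l =
      if l = m then i else s.stack l := by
    simp (disch := omega) only [State.stack, State.storeNat_nats, Function.update_of_ne]
    rw [Function.update_apply]
    congr 1
    simp
  refine ⟨((h.ready.storeNat (by omega) _).storeNat (by omega) _).storeNat (by omega) _, ?_, ?_, ?_,
    by omega, ?_⟩
  · rw [State.storeNat_nats, Function.update_self]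
  · simp (disch := omega) only [State.storeNat_nats, Function.update_of_ne, Function.update_self]
  · refine h.stack.push hi (fun l hl => ?_) ?_ hlt
    · rw [e1, if_neg (by omega)]
    · rw [e1, if_pos rfl]
  · intro hin
    rw [e1, if_pos (by omega)]
    omega

theorem Prog.cost_newtonStep (s : State) : Prog.newtonStep.cost s ≤ 11 := by
  refine Prog.cost_ifNat_le (C := 10) (Prog.cost_ifReal_le (C := 9) (by simp [Prog.cost])
    (Prog.cost_ifNat_le (C := 8) (by simp [Prog.cost, Prog.push]) ?_)) (by simp [Prog.cost])
  exact Nat.add_le_add (le_refl 2) (Nat.add_le_add (le_refl 2)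
    (Prog.cost_ifReal_le (C := 3) (by simp [Prog.cost]) (by simp [Prog.cost, Prog.push])))

/-- The quantity `2 * (n + 1 - i) + m` is the potential of the amortised analysis: a pop lowers `m`
by one, a push raises both `i` and `m` by one, and skipping a zero coefficient lowers it by two.
Once `i = n + 1`, further steps are idle. -/
theorem Prog.run_newtonStep {n N M i m : ℕ} {a : ℕ → ℝ} {s : State} (hnn : ∀ i, 0 ≤ a i)
    (hlast : 0 < a n) (hnN : n < N) (h : NewtonState n N M a i m s) :
    ∃ i' m', NewtonState n N M a i' m' (Prog.newtonStep.run s) ∧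
      (i = n + 1 → i' = n + 1) ∧ (i ≤ n → 2 * (n + 1 - i') + m' + 1 ≤ 2 * (n + 1 - i) + m) := by
  rcases Nat.lt_or_ge n i with hin | hin
  · have hrun : Prog.newtonStep.run s = s := by
      simp only [Prog.newtonStep, Prog.run, NatExpr.eval, h.index, h.ready.deg]
      rw [if_neg (by omega)]
    rw [hrun]
    exact ⟨i, m, h, fun h => h, fun h => absurd h (by omega)⟩
  have hz := h.ready.zero
  rcases (hnn i).eq_or_lt with hi | hi
  · have hrun : Prog.newtonStep.run s = s.storeNat 4 (i + 1) := by
      simp only [Prog.newtonStep, Prog.run, NatExpr.eval, h.index, h.ready.deg, h.ready.length,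
        one_mul, h.ready.entry i hin, add_zero, hz]
      rw [if_pos hin, if_pos hi.symm.le]
    rw [hrun]
    refine ⟨i + 1, m, ⟨h.ready.storeNat (by omega) _, ?_, ?_, ?_, by omega, ?_⟩, by omega,
      by omega⟩
    · rw [State.storeNat_nats, Function.update_self]
    · rw [State.storeNat_nats, Function.update_of_ne (by omega), h.size]
    · have : (s.storeNat 4 (i + 1)).stack = s.stack := by
        ext l
        rw [State.stack, State.storeNat_nats, Function.update_of_ne (by omega)]; rfl
      rw [this]
      exact h.stack.skip hi.symm
    · intro hn
      obtain rfl : i = n := by omega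
      -- The leading coefficient is nonzero, so the last index is never skipped and ends up on top
      -- of the stack.
      exact absurd hi hlast.ne
  rcases Nat.lt_or_ge m 2 with hm | hm
  · have hrun : Prog.newtonStep.run s = Prog.push.run s := by
      simp only [Prog.newtonStep, Prog.run, NatExpr.eval, h.index, h.ready.deg, h.ready.length,
        one_mul, h.ready.entry i hin, add_zero, hz, h.size]
      rw [if_pos hin, if_neg (not_le.2 hi), if_pos (by omega)]
    rw [hrun]
    exact ⟨i + 1, m + 1, h.run_push hi hin (by omega), by omega, by omega⟩
  have htop : NatExpr.top.eval s = s.stack (m - 1) := by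
    simp only [NatExpr.eval, h.size, State.stack]; congr 1; omega
  have hsec : NatExpr.second.eval s = s.stack (m - 2) := by
    simp only [NatExpr.eval, h.size, State.stack]; congr 1; omega
  have l1 := h.stack.lt_next (m - 1) (by omega)
  have l2 := h.stack.lt_next (m - 2) (by omega)
  obtain ⟨w1, e1⟩ := Prog.run_cross h.ready 1 (u := .second) (v := .top) (by omega) (by omega)
  set s1 := (Prog.cross 1 .second .top).run s with hs1
  have r1 : AbsReady n N M a s1 := by
    rw [e1]
    exact (h.ready.storeReal (by omega) (by omega) _).storeReal (by omega) (by omega) _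
  have n1 : s1.nats = s.nats := by rw [e1]; rfl
  have i1 : (NatExpr.cell 4).eval s1 = i := by simp only [NatExpr.eval, n1, h.index]
  have htop1 : NatExpr.top.eval s1 = s.stack (m - 1) := by rw [NatExpr.eval_congr n1, htop]
  obtain ⟨w2, e2⟩ := Prog.run_cross r1 2 (u := .top) (v := .cell 4) (by omega) (by omega)
  set s2 := (Prog.cross 2 .top (.cell 4)).run s1 with hs2
  have r2 : AbsReady n N M a s2 := by
    rw [e2]
    exact (r1.storeReal (by omega) (by omega) _).storeReal (by omega) (by omega) _
  have n2 : s2.nats = s.nats := by rw [e2, ← n1]; rfl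
  have c1 : s2.reals (7 * N + 1) = crossing a (s.stack (m - 2)) (s.stack (m - 1)) := by
    rw [e2, e1, htop, hsec]
    simp (disch := omega) only [State.storeReal_reals, Function.update_of_ne, Function.update_self]
  have c2 : s2.reals (7 * N + 2) = crossing a (s.stack (m - 1)) i := by
    rw [e2, htop1, i1, State.storeReal_reals, Function.update_self]
  have hstack : s2.stack = s.stack := by ext l; rw [State.stack, n2]; rfl
  have h2 : NewtonState n N M a i m s2 :=
    ⟨r2, by rw [n2, h.index], by rw [n2, h.size], by rw [hstack]; exact h.stack, h.le,
      by rw [hstack]; exact h.last⟩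
  have hrun : Prog.newtonStep.run s =
      if crossing a (s.stack (m - 1)) i ≤ crossing a (s.stack (m - 2)) (s.stack (m - 1)) then
        s2.storeNat 5 (m - 1) else Prog.push.run s2 := by
    rw [Prog.newtonStep]
    simp only [Prog.run, NatExpr.eval, h.index, h.ready.deg, h.ready.length,
        one_mul, h.ready.entry i hin, add_zero, hz, h.size, ← hs1, ← hs2, r2.length, c1, c2,
        h2.size]
    rw [if_pos hin, if_neg (not_le.2 hi), if_neg (by omega)]
  rw [hrun]
  split_ifs with hc
  · refine ⟨i, m - 1, ⟨r2.storeNat (by omega) _, ?_, ?_, ?_, h.le, by omega⟩, by omega, by omega⟩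
    · rw [State.storeNat_nats, Function.update_of_ne (by omega), h2.index]
    · rw [State.storeNat_nats, Function.update_self]
    · have : (s2.storeNat 5 (m - 1)).stack = s.stack := by
        ext l
        rw [← hstack, State.stack, State.storeNat_nats, Function.update_of_ne (by omega)]; rfl
      rw [this]
      exact h.stack.pop hi hm hc
  · refine ⟨i + 1, m + 1, h2.run_push hi hin fun _ => ?_, by omega, by omega⟩
    rw [hstack]
    exact not_le.1 hc

/-- Compute the Newton polygon of the array `1`. -/
def Prog.newtonPolygon : Prog :=
  .seq (.setNat (.lit 4) (.lit 0)) <| .seq (.setNat (.lit 5) (.lit 0)) <|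
  .loop (.mul (.lit 2) (.add (.cell 0) (.lit 1))) .newtonStep

theorem Prog.meets_newtonPolygon {n N M : ℕ} {a : ℕ → ℝ} {s : State} (hnn : ∀ i, 0 ≤ a i)
    (hlast : 0 < a n) (hnN : n < N) (h : AbsReady n N M a s) :
    Prog.newtonPolygon.Meets s (27 + 24 * n) fun s' => ∃ m, NewtonState n N M a (n + 1) m s' := by
  have h1 : (Prog.setNat (.lit 4) (.lit 0)).Meets s 1 fun s' => s' = s.storeNat 4 0 := ⟨le_rfl, rfl⟩
  have h2 : (Prog.setNat (.lit 5) (.lit 0)).Meets (s.storeNat 4 0) 1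
    fun s' => s' = (s.storeNat 4 0).storeNat 5 0 := ⟨le_rfl, rfl⟩
  refine (h1.seq (C' := 1 + (1 + (2 * (n + 1)) * (1 + 11))) ?_).mono (by omega) fun _ h => h
  rintro _ rfl
  refine h2.seq ?_
  rintro _ rfl
  -- The potential starts at `2 * (n + 1)` and is at least `2` while `i ≤ n`, so this many passes
  -- reach `i = n + 1`.
  refine (Prog.Meets.loop (m := 2 * (n + 1)) (fun k s' => ∃ i m, NewtonState n N M a i m s' ∧
    (i ≤ n → 2 * (n + 1 - i) + m + k ≤ 2 * (n + 1))) ?_ ?_ ?_).mono le_rfl ?_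
  · simp [NatExpr.eval, State.storeNat_nats, h.deg]
  · refine ⟨0, 0, ⟨(h.storeNat (by omega) _).storeNat (by omega) _, ?_, ?_,
      NewtonStack.empty a _, by omega, by omega⟩, by omega⟩
    · simp [State.storeNat_nats]
    · simp [State.storeNat_nats]
  · rintro k _ s' ⟨i, m, hs, hk⟩
    refine ⟨Prog.cost_newtonStep s', ?_⟩
    obtain ⟨i', m', hs', he, hd⟩ := Prog.run_newtonStep hnn hlast hnN hs
    refine ⟨i', m', hs', fun hi' => ?_⟩
    have := hs.le
    rcases Nat.lt_or_ge n i with hi | hi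
    · have := he (by omega); omega
    · have := hk hi; have := hd hi; omega
  · rintro s' ⟨i, m, hs, hk⟩
    have := hs.le
    obtain rfl : i = n + 1 := by
      by_contra hne
      have := hk (by omega)
      omega
    exact ⟨m, hs⟩

end RealRAM

/-! ### Reading off the radii -/

namespace RealRAM

theorem Prog.run_ifNat_pos {a b : NatExpr} {P Q : Prog} {s : State} (h : a.eval s ≤ b.eval s) :
    (Prog.ifNat a b P Q).run s = P.run s := if_pos h

theorem Prog.run_ifNat_neg {a b : NatExpr} {P Q : Prog} {s : State} (h : ¬ a.eval s ≤ b.eval s) :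
    (Prog.ifNat a b P Q).run s = Q.run s := if_neg h

/-- Pop the topmost vertex if the content of cell `6` is at most the vertex below. -/
def Prog.descend : Prog :=
  .ifNat (.lit 2) (.cell 5)
    (.ifNat (.cell 6) .second (.setNat (.lit 5) (.sub (.cell 5) (.lit 1))) .skip) .skip

/-- Store the approximation that belongs to the topmost edge. -/
def Prog.emit : Prog :=
  .ifNat (.lit 2) (.cell 5)
    (.seq (.arith .div (.cell 4) (.arr 1 .second) (.arr 1 .top)) <|
      .seq (.root (.cell 4) (.mul (.cell 3) (.sub .top .second)) (.cell 4)) <|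
      .seq (.setReal (.arr 7 (.lit 1)) (.div (.cell 3) (.cell 1))) <|
      .seq (.arith .mul (.cell 4) (.cell 4) (.arr 7 (.lit 1))) <|
      .seq (.setReal (.arr 7 (.lit 1)) (.add (.div (.cell 3) (.cell 1)) (.lit 1))) <|
      .arith .div (.cell 4) (.cell 4) (.arr 7 (.lit 1)))
    (.setReal (.cell 4) (.lit 0))

/-- Store the approximations to the root radii in the array `0`. -/
def Prog.emitAll : Prog :=
  .forUpTo (.cell 0) <| .seq (.setNat (.lit 6) (.sub (.cell 0) (.cell 4))) <| .seq .descend .emit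

/-- It lets the program take the `M`-th root of a crossing by a single root extraction from the
quotient of two coefficients. -/
theorem rootOp_mul {m w : ℕ} (hm : 1 ≤ m) (hw : 1 ≤ w) {x : ℝ} (hx : 0 ≤ x) :
    rootOp (m * w) x = rootOp m (rootOp w x) := by
  have h1 : rootOp w x = x ^ ((w : ℝ)⁻¹) := if_pos ⟨hw, hx⟩
  have h2 : 0 ≤ x ^ ((w : ℝ)⁻¹) := Real.rpow_nonneg hx _
  rw [h1, rootOp, rootOp, if_pos ⟨Nat.mul_pos hm hw, hx⟩, if_pos ⟨hm, h2⟩, ← Real.rpow_mul hx]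
  congr 1
  push_cast
  rw [mul_inv, mul_comm]

theorem rootOp_zero {m : ℕ} (hm : 1 ≤ m) : rootOp m 0 = 0 := by
  rw [rootOp, if_pos ⟨hm, le_rfl⟩, Real.zero_rpow]
  have : (0 : ℝ) < m := by exact_mod_cast hm
  positivity

/-- The number computed from the radius `ρ` in the Newton polygon. -/
noncomputable def approxRadius (M N : ℕ) (ρ : ℝ) : ℝ :=
  rootOp M ρ * ((M / N : ℕ) : ℝ) / ((M / N + 1 : ℕ) : ℝ)

/-- The state while the approximations are being stored: `i` of them are there, and cell `5` holds
the current position on the stack `st`. -/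
structure EmitState (n N M : ℕ) (a : ℕ → ℝ) (st : ℕ → ℕ) (m i : ℕ) (s : State) : Prop where
  ready : AbsReady n N M a s
  stack : s.stack = st
  one_le : 1 ≤ s.nats 5
  le : s.nats 5 ≤ m
  le_top : n - i ≤ st (s.nats 5 - 1)
  second_le : 2 ≤ s.nats 5 → st (s.nats 5 - 2) ≤ n - i
  done : ∀ j < i, ∃ ρ, IsNewtonRadius a n j ρ ∧ s.reals j = approxRadius M N ρ

theorem stack_storeNat {s : State} {k : ℕ} (hk : k < 16) (v : ℕ) :
    (s.storeNat k v).stack = s.stack := by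
  ext l
  rw [State.stack, State.storeNat_nats, Function.update_of_ne (by omega)]; rfl

theorem State.stack_sub {s : State} {b : ℕ} (hb : b ≤ s.nats 5) (hb' : b ≤ 16) :
    s.nats (16 - b + s.nats 5) = s.stack (s.nats 5 - b) := by
  rw [State.stack]; congr 1; omega

/-- One pop per radius is enough: `n - i` drops by one at a time and the vertices are distinct
integers, so at most one vertex is passed. -/
theorem Prog.run_descend {n N M m i : ℕ} {a : ℕ → ℝ} {st : ℕ → ℕ} {s : State}
    (hst : NewtonStack a st m (n + 1)) (h : EmitState n N M a st m i s) (h4 : s.nats 4 = i)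
    (h6 : s.nats 6 = n - i) :
    EmitState n N M a st m i (Prog.descend.run s) ∧ (Prog.descend.run s).nats 4 = i ∧
      (2 ≤ (Prog.descend.run s).nats 5 → st ((Prog.descend.run s).nats 5 - 2) < n - i) := by
  by_cases hk : 2 ≤ s.nats 5
  · have hsec : s.nats (14 + s.nats 5) = st (s.nats 5 - 2) := by
      rw [← h.stack]; exact State.stack_sub hk (by omega)
    by_cases hle : n - i ≤ st (s.nats 5 - 2)
    · have hrun : Prog.descend.run s = s.storeNat 5 (s.nats 5 - 1) := by
        rw [Prog.descend, Prog.run_ifNat_pos (a := .lit 2) (b := .cell 5) hk, Prog.run_ifNat_pos]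
        · rfl
        · simpa only [NatExpr.eval, hsec, h6] using hle
      have h5 : (s.storeNat 5 (s.nats 5 - 1)).nats 5 = s.nats 5 - 1 := by
        rw [State.storeNat_nats, Function.update_self]
      rw [hrun]
      have key : 2 ≤ s.nats 5 - 1 → st (s.nats 5 - 1 - 2) < n - i := by
        intro h2
        have h3 := hst.mono (s.nats 5 - 1 - 2) (by have := h.le; omega)
        rw [show s.nats 5 - 1 - 2 + 1 = s.nats 5 - 2 by omega] at h3
        exact h3.trans_le (h.second_le hk)
      have hle' := h.le
      refine ⟨⟨h.ready.storeNat (by omega) _, by rw [stack_storeNat (by omega), h.stack], ?_, ?_,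
        ?_, ?_, h.done⟩, ?_, ?_⟩
      · omega
      · omega
      · rw [h5]; exact hle.trans (le_of_eq (congrArg st (by omega)))
      · rw [h5]; exact fun h2 => (key h2).le
      · rw [State.storeNat_nats, Function.update_of_ne (by omega), h4]
      · rw [h5]; exact key
    · have hrun : Prog.descend.run s = s := by
        rw [Prog.descend, Prog.run_ifNat_pos (a := .lit 2) (b := .cell 5) hk, Prog.run_ifNat_neg]
        · rfl
        · simpa only [NatExpr.eval, hsec, h6] using hle
      rw [hrun]
      exact ⟨h, h4, fun _ => not_le.1 hle⟩
  · have hrun : Prog.descend.run s = s := by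
      rw [Prog.descend, Prog.run_ifNat_neg (a := .lit 2) (b := .cell 5) hk]; rfl
    rw [hrun]
    exact ⟨h, h4, fun h => absurd h hk⟩

theorem Prog.run_emit {n N M m i : ℕ} {a : ℕ → ℝ} {st : ℕ → ℕ} {s : State}
    (hst : NewtonStack a st m (n + 1)) (ha : ∀ i, n < i → a i = 0) (hM : 1 ≤ M)
    (hin : i < n) (hnN : n < N) (h : EmitState n N M a st m i s)
    (h4 : s.nats 4 = i) (hlt : 2 ≤ s.nats 5 → st (s.nats 5 - 2) < n - i) :
    ∃ ρ w, IsNewtonRadius a n i ρ ∧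
      ∀ x, (Prog.emit.run s).reals x =
        if x = i then approxRadius M N ρ else if x = 7 * N + 1 then w else s.reals x := by
  by_cases hk : 2 ≤ s.nats 5
  · set v := st (s.nats 5 - 1) with hv
    set u := st (s.nats 5 - 2) with hu
    have hle := h.le
    have hsec : s.nats (14 + s.nats 5) = u := by
      rw [hu, ← h.stack]; exact State.stack_sub hk (by omega)
    have htop : s.nats (15 + s.nats 5) = v := by
      rw [hv, ← h.stack]; exact State.stack_sub h.one_le (by omega)
    have hidx : s.nats 5 - 2 + 1 = s.nats 5 - 1 := by omega
    have huv : u < v := by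
      have := hst.mono (s.nats 5 - 2) (by omega)
      rwa [hidx] at this
    have hvn : v ≤ n := by have := hst.lt_next (s.nats 5 - 1) (by omega); omega
    have hpu : 0 < a u := hst.pos _ (by omega)
    have hpv : 0 < a v := hst.pos _ (by omega)
    have hρ := hst.isNewtonRadius_crossing (j := i) (l := s.nats 5 - 2) ha (by omega) (hlt hk)
      (by rw [hidx]; exact h.le_top)
    rw [hidx] at hρ
    refine ⟨_, ((M / N + 1 : ℕ) : ℝ), hρ, fun x => ?_⟩
    have hroot : approxRadius M N (crossing a u v) =
        rootOp (M * (v - u)) (a u / a v) * ((M / N : ℕ) : ℝ) / ((M / N + 1 : ℕ) : ℝ) := by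
      rw [approxRadius, crossing, rootOp_mul hM (by omega) (by positivity)]
    rw [← hu, ← hv, hroot]
    rw [Prog.emit, Prog.run_ifNat_pos (a := .lit 2) (b := .cell 5) hk]
    simp (disch := omega) only [Prog.run, NatExpr.eval, State.storeReal_nats,
      State.storeReal_reals, hsec, htop, h4,
      h.ready.length, h.ready.exponent, one_mul, h.ready.entry u (by omega),
      h.ready.entry v hvn, ArithOp.eval, Function.update_self, Function.update_of_ne]
    simp only [Function.update_apply]
    split_ifs <;> rfl
  -- A single vertex is left, so the index `n - i` lies at or below the lowest nonzero coefficient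
  -- and the radius is zero.
  · refine ⟨0, s.reals (7 * N + 1), hst.isNewtonRadius_zero
      (by have := h.one_le; have := h.le; omega) ?_,
      fun x => ?_⟩
    · have := h.le_top
      have h5 : s.nats 5 - 1 = 0 := by omega
      rwa [h5] at this
    · rw [Prog.emit, Prog.run_ifNat_neg (a := .lit 2) (b := .cell 5) hk]
      simp only [Prog.run, NatExpr.eval]
      rw [State.storeReal_reals, h4, approxRadius, rootOp_zero hM, Function.update_apply]
      split_ifs with h1 h2
      · simp
      · rw [h2]
      · rfl

theorem Prog.nats_emit (s : State) : (Prog.emit.run s).nats = s.nats := by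
  by_cases h : (NatExpr.lit 2).eval s ≤ (NatExpr.cell 5).eval s
  · rw [Prog.emit, Prog.run_ifNat_pos h]; rfl
  · rw [Prog.emit, Prog.run_ifNat_neg h]; rfl

theorem Prog.meets_emitAll {n N M m : ℕ} {a : ℕ → ℝ} {s : State} (ha : ∀ i, n < i → a i = 0)
    (hM : 1 ≤ M) (hnN : n < N) (h : NewtonState n N M a (n + 1) m s) :
    Prog.emitAll.Meets s (2 + n * 13) fun s' =>
      ∀ j < n, ∃ ρ, IsNewtonRadius a n j ρ ∧ s'.reals j = approxRadius M N ρ := by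
  obtain ⟨hm, hlast⟩ := h.last rfl
  refine (Prog.Meets.forUpTo (m := n) (C := 11) (EmitState n N M a s.stack m) ?_ ?_ ?_).mono
    le_rfl fun s' h => h.done
  · simp [NatExpr.eval, State.storeNat_nats, h.ready.deg]
  · have h5 : (s.storeNat 4 0).nats 5 = m := by
      rw [State.storeNat_nats, Function.update_of_ne (by omega), h.size]
    refine ⟨h.ready.storeNat le_rfl _, stack_storeNat (by omega) _, by omega, by omega, ?_, ?_,
      by omega⟩
    · rw [h5, hlast]; omega
    · rw [h5]
      intro h2
      have := h.stack.lt_next (m - 2) (by omega)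
      omega
  · intro i hi s' h4 hs
    have hcost : (Prog.seq (.setNat (.lit 6) (.sub (.cell 0) (.cell 4)))
        (.seq .descend .emit)).cost s' ≤ 11 := by
      refine Nat.add_le_add (le_refl 1) (Nat.add_le_add (a := _) (b := 3) (d := 7) ?_ ?_)
      · exact Prog.cost_ifNat_le (C := 2) (Prog.cost_ifNat_le (C := 1) (by simp [Prog.cost])
          (by simp [Prog.cost])) (by simp [Prog.cost])
      · exact Prog.cost_ifNat_le (C := 6) (by simp [Prog.cost]) (by simp [Prog.cost])
    refine ⟨hcost, ?_⟩
    have hrun : (Prog.seq (.setNat (.lit 6) (.sub (.cell 0) (.cell 4)))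
        (.seq .descend .emit)).run s' =
        Prog.emit.run (Prog.descend.run (s'.storeNat 6 (n - i))) := by
      simp only [Prog.run, NatExpr.eval, hs.ready.deg, h4]
    rw [hrun]
    have hs1 : EmitState n N M a s.stack m i (s'.storeNat 6 (n - i)) := by
      have h5 : (s'.storeNat 6 (n - i)).nats 5 = s'.nats 5 := by
        rw [State.storeNat_nats, Function.update_of_ne (by omega)]
      exact ⟨hs.ready.storeNat (by omega) _, by rw [stack_storeNat (by omega), hs.stack],
        by rw [h5]; exact hs.one_le, by rw [h5]; exact hs.le, by rw [h5]; exact hs.le_top,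
        by rw [h5]; exact hs.second_le, hs.done⟩
    obtain ⟨hs2, h42, hlt⟩ := Prog.run_descend h.stack hs1
      (by rw [State.storeNat_nats, Function.update_of_ne (by omega), h4])
      (by rw [State.storeNat_nats, Function.update_self])
    set s2 := Prog.descend.run (s'.storeNat 6 (n - i)) with hs2def
    obtain ⟨ρ, w, hρ, hr⟩ := Prog.run_emit h.stack ha hM hi hnN hs2 h42 hlt
    have hn := Prog.nats_emit s2
    set s3 := Prog.emit.run s2 with hs3def
    have h5 : (s3.storeNat 4 (i + 1)).nats 5 = s2.nats 5 := by
      rw [State.storeNat_nats, Function.update_of_ne (by omega), hn]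
    refine ⟨by rw [hn, h42], ?_, ?_, ?_, ?_, ?_, ?_, ?_⟩
    · refine AbsReady.storeNat ⟨?_, ?_, ?_, fun k hk => ?_, ?_⟩ le_rfl _
      · rw [hn, hs2.ready.deg]
      · rw [hn, hs2.ready.length]
      · rw [hn, hs2.ready.exponent]
      · rw [hr, if_neg (by omega), if_neg (by omega), hs2.ready.entry k hk]
      · rw [hr, if_neg (by omega), if_neg (by omega), hs2.ready.zero]
    · rw [stack_storeNat (by omega), ← hs2.stack]
      ext l
      rw [State.stack, hn]; rfl
    · rw [h5]; exact hs2.one_le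
    · rw [h5]; exact hs2.le
    · rw [h5]; have := hs2.le_top; omega
    · rw [h5]; intro h2; have := hlt h2; omega
    · intro j hj
      rw [State.storeNat_reals]
      rcases Nat.lt_succ_iff_lt_or_eq.1 hj with hj | rfl
      · rw [hr, if_neg (by omega), if_neg (by omega)]
        exact hs2.done j hj
      · exact ⟨ρ, hρ, by rw [hr, if_pos rfl]⟩

/-- Compute approximations to the root radii. -/
def Prog.rootRadii (κ D : ℕ) : Prog :=
  .seq (.powerRoots κ D) <| .seq .absArray <| .seq .newtonPolygon .emitAll

/-! ### Precision, total cost and conclusion -/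

theorem two_le_one_add_inv_pow {E : ℕ} (hE : 1 ≤ E) : (2 : ℝ) ≤ (1 + (E : ℝ)⁻¹) ^ E := by
  have hE' : (0 : ℝ) < E := by exact_mod_cast hE
  have h := one_add_mul_le_pow (a := (E : ℝ)⁻¹) (by have : (0 : ℝ) ≤ (E : ℝ)⁻¹ := by positivity
                                                    linarith) E
  rw [mul_inv_cancel₀ hE'.ne'] at h
  linarith

/-- With `y = 1 + 1 / E`, the `M`-th root `x` of `ρ` is within a factor `y` of `r` on either side.
Division by `y` makes the approximation one-sided, at the price of a total factor `y ^ 2 ≤ 1 + 3 /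
E`. -/
theorem approxRadius_bounds {n N E : ℕ} (hE : 1 ≤ E) (hN : 2 * n < N) {r ρ : ℝ} (hr : 0 ≤ r)
    (hρ : 0 ≤ ρ) (h1 : r ^ (E * N) ≤ 4 ^ n * ρ) (h2 : ρ ≤ 4 ^ n * r ^ (E * N)) :
    approxRadius (E * N) N ρ ≤ r ∧ r ≤ (1 + 3 / (E : ℝ)) * approxRadius (E * N) N ρ := by
  have hNpos : 0 < N := by omega
  have hM : 1 ≤ E * N := Nat.mul_pos hE hNpos
  have hE' : (1 : ℝ) ≤ E := by exact_mod_cast hE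
  set x := rootOp (E * N) ρ with hx
  have hx' : x = ρ ^ (((E * N : ℕ) : ℝ)⁻¹) := if_pos ⟨hM, hρ⟩
  have hx0 : 0 ≤ x := by rw [hx']; positivity
  have hxM : x ^ (E * N) = ρ := by
    rw [hx']; exact Real.rpow_inv_natCast_pow hρ (by omega)
  set y : ℝ := 1 + (E : ℝ)⁻¹ with hy
  have hy0 : 0 < y := by positivity
  have hyM : 4 ^ n ≤ y ^ (E * N) := by
    calc (4 : ℝ) ^ n = 2 ^ (2 * n) := by rw [pow_mul]; norm_num
      _ ≤ 2 ^ N := pow_le_pow_right₀ (by norm_num) hN.le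
      _ ≤ (y ^ E) ^ N := pow_le_pow_left₀ (by norm_num) (two_le_one_add_inv_pow hE) _
      _ = _ := (pow_mul _ _ _).symm
  have b1 : r ≤ y * x := by
    refine le_of_pow_le_pow_left₀ (by omega : E * N ≠ 0) (by positivity) ?_
    rw [mul_pow, hxM]
    exact h1.trans (mul_le_mul_of_nonneg_right hyM hρ)
  have b2 : x ≤ y * r := by
    refine le_of_pow_le_pow_left₀ (by omega : E * N ≠ 0) (by positivity) ?_
    rw [mul_pow, hxM]
    exact h2.trans (mul_le_mul_of_nonneg_right hyM (by positivity))
  have hval : approxRadius (E * N) N ρ = x / y := by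
    rw [approxRadius, Nat.mul_div_cancel _ hNpos, ← hx, hy]
    push_cast
    field_simp
  rw [hval]
  refine ⟨(div_le_iff₀ hy0).2 (by linarith), b1.trans ?_⟩
  have hyy : y ^ 2 ≤ 1 + 3 / (E : ℝ) := by
    have hi : (E : ℝ)⁻¹ ≤ 1 := inv_le_one_of_one_le₀ hE'
    have hi0 : 0 ≤ (E : ℝ)⁻¹ := by positivity
    rw [hy, div_eq_mul_inv]
    nlinarith
  calc y * x = y ^ 2 * (x / y) := by field_simp
    _ ≤ _ := mul_le_mul_of_nonneg_right hyy (by positivity)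

theorem Prog.meets_rootRadii (κ D : ℕ) {p : Polynomial ℝ} (hp : 1 ≤ p.natDegree) :
    ∃ l q s, PoweredRoots κ D p s l q ∧ (Prog.rootRadii κ D).Meets (inputState p)
      (100 * (κ + D + 1) * 2 ^ (l + 1) * (l + 2) ^ 2 + (36 + p.natDegree * 41)) fun s' =>
        ∀ j < p.natDegree, ∃ ρ, IsNewtonRadius (fun i => |q.coeff i|) p.natDegree j ρ ∧
          s'.reals j = approxRadius (2 ^ (κ + (D + 1) * (l + 1))) (2 ^ (l + 1)) ρ := by
  obtain ⟨l, q, hq, c1⟩ := Prog.cost_powerRoots_and_run κ D hp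
  set s1 := (Prog.powerRoots κ D).run (inputState p) with hs1
  have hpower : (Prog.powerRoots κ D).Meets (inputState p) _ fun s' => s' = s1 := ⟨c1, hs1.symm⟩
  refine ⟨l, q, s1, hq, hpower.seq ?_⟩
  rintro _ rfl
  set n := p.natDegree with hn
  set N := 2 ^ (l + 1) with hN
  have hlt : n < N := by have := hq.lt_pow; omega
  have hlast : 0 < |q.coeff n| := by
    have h0 : q.leadingCoeff ≠ 0 := Polynomial.leadingCoeff_ne_zero.2 hq.ne_zero
    rw [Polynomial.leadingCoeff, hq.natDegree_eq] at h0
    exact abs_pos.2 h0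
  have hbig : ∀ i, n < i → |q.coeff i| = 0 := by
    intro i hi
    rw [abs_eq_zero]
    exact Polynomial.coeff_eq_zero_of_natDegree_lt (by rw [hq.natDegree_eq]; exact hi)
  have hrest : (Prog.seq .absArray (.seq .newtonPolygon .emitAll)).Meets s1
      ((7 + n * 4) + ((27 + 24 * n) + (2 + n * 13))) fun s' =>
        ∀ j < n, ∃ ρ, IsNewtonRadius (fun i => |q.coeff i|) n j ρ ∧
          s'.reals j = approxRadius (2 ^ (κ + (D + 1) * (l + 1))) N ρ := by
    refine (Prog.meets_absArray hq.cell_zero hq.cell_one hq.cell_three hlt).seq fun s2 r2 => ?_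
    have r2' : AbsReady n N (2 ^ (κ + (D + 1) * (l + 1))) (fun i => |q.coeff i|) s2 :=
      ⟨r2.deg, r2.length, r2.exponent,
        fun i hi => by rw [r2.entry i hi, hq.coeff i (by omega)], r2.zero⟩
    refine (Prog.meets_newtonPolygon (fun i => abs_nonneg _) hlast hlt r2').seq ?_
    rintro s3 ⟨m, r3⟩
    exact Prog.meets_emitAll hbig Nat.one_le_two_pow hlt r3
  exact hrest.mono (by omega) fun _ h => h

theorem cost_bound_le {G n l : ℕ} (hG : 1 ≤ G) (hn : 1 ≤ n) (hle : 2 ^ (l + 1) ≤ 4 * n) :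
    100 * G * 2 ^ (l + 1) * (l + 2) ^ 2 + (36 + n * 41) ≤
      500 * G * n * (Nat.log 2 n + 3) ^ 2 := by
  have hl : l + 2 ≤ Nat.log 2 n + 3 := by
    -- The factor `4` is split so that each doubling adds exactly one to the logarithm.
    have h2 : l + 1 ≤ Nat.log 2 (n * 2 * 2) :=
      Nat.le_log_of_pow_le (by norm_num) (by omega)
    rw [Nat.log_mul_base (by norm_num) (by omega), Nat.log_mul_base (by norm_num) (by omega)] at h2
    omega
  set X := Nat.log 2 n + 3 with hX
  have hX2 : (l + 2) ^ 2 ≤ X ^ 2 := Nat.pow_le_pow_left hl 2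
  have hGX : 1 ≤ G * X ^ 2 := Nat.mul_pos hG (by positivity)
  have hnX : n ≤ G * X ^ 2 * n := Nat.le_mul_of_pos_left _ hGX
  calc _ ≤ 100 * G * (4 * n) * X ^ 2 + 100 * (G * X ^ 2 * n) :=
        Nat.add_le_add (Nat.mul_le_mul (Nat.mul_le_mul_left _ hle) hX2) (by omega)
    _ = _ := by ring

theorem Prog.rootRadii_correct (κ D : ℕ) {p : Polynomial ℝ} (hp : 1 ≤ p.natDegree) :
    (Prog.rootRadii κ D).cost (inputState p) ≤
        500 * (κ + D + 1) * p.natDegree * (Nat.log 2 p.natDegree + 3) ^ 2 ∧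
      ∀ j : Fin p.natDegree,
        ((Prog.rootRadii κ D).run (inputState p)).reals j ≤ rootRadius p j ∧
        rootRadius p j ≤ (1 + 3 / ((2 : ℝ) ^ κ * (p.natDegree : ℝ) ^ D)) *
          ((Prog.rootRadii κ D).run (inputState p)).reals j := by
  obtain ⟨l, q, _, hq, hcost, hrun⟩ := Prog.meets_rootRadii κ D hp
  refine ⟨hcost.trans (cost_bound_le (by omega) hp hq.pow_le), fun j => ?_⟩
  obtain ⟨ρ, hρ, hval⟩ := hrun j j.2
  rw [hval]
  obtain ⟨h0, h1, h2⟩ := (tropicallyClose_of_roots_eq hq.ne_zero hq.natDegree_eq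
    hq.roots_eq).isNewtonRadius (fun i => abs_nonneg _)
      (fun j => pow_nonneg (rootRadius_nonneg p j) _) hρ
  have hlt := hq.lt_pow
  obtain ⟨N, hN⟩ : ∃ N, N = 2 ^ (l + 1) := ⟨_, rfl⟩
  obtain ⟨E, hE⟩ : ∃ E, E = 2 ^ (κ + D * (l + 1)) := ⟨_, rfl⟩
  have hM : 2 ^ (κ + (D + 1) * (l + 1)) = E * N := by
    rw [hE, hN, ← pow_add, add_mul, one_mul, ← add_assoc]
  have hE1 : 1 ≤ E := hE ▸ Nat.one_le_two_pow
  simp only [hM] at h1 h2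
  rw [hM, ← hN]
  rw [← hN] at hlt
  have hr := rootRadius_nonneg p j
  obtain ⟨b1, b2⟩ := approxRadius_bounds hE1 hlt hr h0 h1 h2
  refine ⟨b1, b2.trans ?_⟩
  refine mul_le_mul_of_nonneg_right ?_ ?_
  · have hn0 : (0 : ℝ) < p.natDegree := by exact_mod_cast hp
    -- Since `E = 2 ^ κ * N ^ D`, the inequality `n ≤ N` suffices; the bound `N ≤ 4 * n` is needed
    -- only for the cost.
    have hEN : (2 : ℝ) ^ κ * (p.natDegree : ℝ) ^ D ≤ (E : ℝ) := by
      have hnN : (p.natDegree : ℝ) ≤ (N : ℝ) := by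
        exact_mod_cast (by omega : p.natDegree ≤ N)
      calc (2 : ℝ) ^ κ * (p.natDegree : ℝ) ^ D ≤ 2 ^ κ * (N : ℝ) ^ D := by gcongr
        _ = _ := by rw [hN, hE]; push_cast; rw [← pow_mul, ← pow_add, mul_comm (l + 1)]
    exact add_le_add_right (div_le_div_of_nonneg_left (by norm_num) (by positivity) hEN) 1
  · refine nonneg_of_mul_nonneg_right (hr.trans b2) ?_
    positivity

theorem isBigO_mul_natLog_sq (C : ℕ) :
    (fun n : ℕ => ((C * n * (Nat.log 2 n + 3) ^ 2 : ℕ) : ℝ)) =O[Filter.atTop]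
      fun n : ℕ => (n : ℝ) * Real.log (n : ℝ) ^ 2 := by
  refine Asymptotics.IsBigO.of_bound (C * (4 / Real.log 2) ^ 2) ?_
  filter_upwards [Filter.eventually_ge_atTop 2] with n hn
  have h2 : 0 < Real.log 2 := Real.log_pos (by norm_num)
  have hn' : (2 : ℝ) ≤ n := by exact_mod_cast hn
  have hlog : Real.log 2 ≤ Real.log n := Real.log_le_log (by norm_num) hn'
  have h1 : ((Nat.log 2 n : ℕ) : ℝ) ≤ Real.log n / Real.log 2 := by
    have := Real.natLog_le_logb n 2
    rwa [Real.logb, Nat.cast_ofNat] at this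
  have h3 : 1 ≤ Real.log n / Real.log 2 := (one_le_div h2).2 hlog
  have h4 : ((Nat.log 2 n : ℕ) : ℝ) + 3 ≤ 4 / Real.log 2 * Real.log n := by
    calc _ ≤ 4 * (Real.log n / Real.log 2) := by linarith
      _ = _ := by ring
  rw [Real.norm_of_nonneg (by positivity), Real.norm_of_nonneg (by positivity)]
  push_cast
  calc (C : ℝ) * n * ((Nat.log 2 n : ℕ) + 3) ^ 2
      ≤ C * n * (4 / Real.log 2 * Real.log n) ^ 2 := by gcongr
    _ = _ := by ring

end RealRAM

theorem theoremD3 (c d : ℝ) (hc : 0 < c) :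
    ∃ (P : RealRAM.Prog) (T : ℕ → ℕ),
      ((fun n : ℕ => (T n : ℝ)) =O[Filter.atTop] fun n : ℕ => (n : ℝ) * Real.log (n : ℝ) ^ 2) ∧
      ∀ p : Polynomial ℝ, 1 ≤ p.natDegree →
        P.cost (RealRAM.inputState p) ≤ T p.natDegree ∧
        ∀ j : Fin p.natDegree,
          (P.run (RealRAM.inputState p)).reals j ≤ rootRadius p j ∧
          rootRadius p j ≤
            (1 + c / (p.natDegree : ℝ) ^ d) * (P.run (RealRAM.inputState p)).reals j := by
  -- The program depends on `c` and `d` only through the naturals `D ≥ d` and `κ` with `2 ^ κ > 3 /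
  -- c`; the `3` is the one in the error bound `1 + 3 / E`.
  obtain ⟨D, hD⟩ := exists_nat_ge d
  obtain ⟨κ, hκ⟩ := pow_unbounded_of_one_lt (3 / c) (by norm_num : (1 : ℝ) < 2)
  refine ⟨RealRAM.Prog.rootRadii κ D, fun n => 500 * (κ + D + 1) * n * (Nat.log 2 n + 3) ^ 2,
    RealRAM.isBigO_mul_natLog_sq _, fun p hp => ?_⟩
  obtain ⟨hcost, hrad⟩ := RealRAM.Prog.rootRadii_correct κ D hp
  refine ⟨hcost, fun j => ⟨(hrad j).1, (hrad j).2.trans ?_⟩⟩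
  have hn : (1 : ℝ) ≤ p.natDegree := by exact_mod_cast hp
  have hpow : (p.natDegree : ℝ) ^ d ≤ (p.natDegree : ℝ) ^ D := by
    rw [← Real.rpow_natCast]; exact Real.rpow_le_rpow_of_exponent_le hn hD
  have hnonneg : 0 ≤ ((RealRAM.Prog.rootRadii κ D).run (RealRAM.inputState p)).reals j :=
    nonneg_of_mul_nonneg_right ((rootRadius_nonneg p j).trans (hrad j).2) (by positivity)
  refine mul_le_mul_of_nonneg_right ?_ hnonneg
  have hd : 0 < (p.natDegree : ℝ) ^ d := Real.rpow_pos_of_pos (by linarith) d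
  have hκ' : 3 ≤ c * 2 ^ κ := by
    rw [div_lt_iff₀ hc] at hκ; linarith
  have : 3 / ((2 : ℝ) ^ κ * (p.natDegree : ℝ) ^ D) ≤ c / (p.natDegree : ℝ) ^ d := by
    rw [div_le_div_iff₀ (by positivity) hd]
    calc 3 * (p.natDegree : ℝ) ^ d ≤ c * 2 ^ κ * (p.natDegree : ℝ) ^ D := by gcongr
      _ = _ := by ring
  linarith
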